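/- Let $d\ge 1$, let $E,Z\subset\mathbb{R}^d$ and $T\subset\mathbb{R}_{>0}$ be non-empty Borel sets, and put $TE=\{rx: r\in T,\ x\in E\}$ and $TE+Z=\{rx+z: r\in T,\ x\in E,\ z\in Z\}$. Write $\dim_{\mathcal H}$ for Hausdorff dimension and $\mathcal{L}^d$ for Lebesgue (outer) measure on $\mathbb{R}^d$. For $A\subset\mathbb{R}^d$ let $\mathcal{M}(A)$ be the set of non-zero Radon measures on $\mathbb{R}^d$ with compact support contained in $A$, and for a finite Borel measure $\mu$ on $\mathbb{R}^d$ let $\widehat\mu(\xi)=\int e^{-2\pi i\xi\cdot x}\,d\mu(x)$. The Fourier dimension of $A$ is $$\dim_{\mathcal F}A=\sup\Big\{s\le d:\ \exists\,\mu\in\mathcal{M}(A),\ \exists\, C,\ |\widehat\mu(\xi)|\le C(1+|\xi|)^{-s/2}\ \text{for all }\xi\in\mathbb{R}^d\Big\}.$$ The Sobolev dimension of a measure $\mu\in\mathcal{M}(\mathbb{R}^d)$ and of the set $A$ are $$\dim_{\mathcal S}\mu=\sup\Big\{s\in\mathbb{R}:\ \int|\widehat\mu(x)|^2(1+|x|)^{s-d}\,dx<\infty\Big\},\qquad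 \dim_{\mathcal S}A=\sup\big\{\dim_{\mathcal S}\mu:\ \mu\in\mathcal{M}(A)\text{ a probability measure}\big\}.$$ Then the following hold. (i) $\dim_{\mathcal F}(TE)\ge\dim_{\mathcal H}E+\dim_{\mathcal H}T-d$, and $\dim_{\mathcal S}(TE+Z)\ge\dim_{\mathcal H}E+\dim_{\mathcal H}Z+\dim_{\mathcal H}T-d$. (ii) If $\dim_{\mathcal H}E+\dim_{\mathcal H}Z+\dim_{\mathcal H}T>2d$, then $\mathcal{L}^d(TE+Z)>0$. (iii) For $0<u<d$, if $\dim_{\mathcal H}E+\dim_{\mathcal H}Z+\dim_{\mathcal H}T>d+u$, then $\dim_{\mathcal H}(TE+Z)\ge u$. -/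

import Mathlib

open MeasureTheory
open scoped Pointwise ENNReal

/-- `HasCompactSupportIn μ A` says that `μ` is a non-zero Radon measure on `ℝ^d` whose (closed)
support is compact and contained in `A`, i.e. `μ ∈ 𝓜(A)`. On `ℝ^d` the Radon measures are exactly
the locally finite Borel measures. -/
structure HasCompactSupportIn {d : ℕ} (μ : Measure (EuclideanSpace ℝ (Fin d)))
    (A : Set (EuclideanSpace ℝ (Fin d))) : Prop where
  ne_zero : μ ≠ 0
  locallyFinite : IsLocallyFiniteMeasure μ
  isCompact_support : IsCompact μ.support
  support_subset : μ.support ⊆ A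

/-- The Fourier transform `ξ ↦ ∫ exp (-2πi ξ·x) dμ(x)` of a measure on `ℝ^d`. -/
noncomputable def measureFourier {d : ℕ} (μ : Measure (EuclideanSpace ℝ (Fin d)))
    (ξ : EuclideanSpace ℝ (Fin d)) : ℂ :=
  ∫ x, Complex.exp (-2 * (Real.pi : ℂ) * Complex.I * ((inner ℝ ξ x : ℝ) : ℂ)) ∂μ

/-- The Fourier dimension of a subset of `ℝ^d`: the supremum of the real `s ≤ d` for which some
`μ ∈ 𝓜(A)` satisfies `|μ̂(ξ)| ≤ C (1 + |ξ|)^(-s/2)` for all `ξ`. -/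
noncomputable def fourierDim {d : ℕ} (A : Set (EuclideanSpace ℝ (Fin d))) : EReal :=
  sSup {t : EReal | ∃ s : ℝ, t = (s : EReal) ∧ s ≤ (d : ℝ) ∧
    ∃ μ : Measure (EuclideanSpace ℝ (Fin d)), HasCompactSupportIn μ A ∧
      ∃ C : ℝ, ∀ ξ : EuclideanSpace ℝ (Fin d),
        ‖measureFourier μ ξ‖ ≤ C * (1 + ‖ξ‖) ^ (-s / 2)}

/-- The Sobolev dimension of a measure on `ℝ^d`: the supremum of the real `s` with
`∫ |μ̂(x)|² (1 + |x|)^(s - d) dx < ∞`. -/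
noncomputable def sobolevDimMeasure {d : ℕ} (μ : Measure (EuclideanSpace ℝ (Fin d))) : EReal :=
  sSup {t : EReal | ∃ s : ℝ, t = (s : EReal) ∧
    ∫⁻ x : EuclideanSpace ℝ (Fin d),
      ENNReal.ofReal (‖measureFourier μ x‖ ^ 2 * (1 + ‖x‖) ^ (s - (d : ℝ))) < ∞}

/-- The Sobolev dimension of a subset `A` of `ℝ^d`: the supremum of the Sobolev dimensions of the
Borel probability measures with compact support contained in `A`. -/
noncomputable def sobolevDim {d : ℕ} (A : Set (EuclideanSpace ℝ (Fin d))) : EReal :=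
  sSup {t : EReal | ∃ μ : Measure (EuclideanSpace ℝ (Fin d)),
    IsProbabilityMeasure μ ∧ HasCompactSupportIn μ A ∧ t = sobolevDimMeasure μ}

/-! Everything rests on one Fourier estimate. Let `μ` on `E` and `ν` on `T` be Frostman measures of
exponents `a` and `τ`, and let `λ` be the image of `ν × μ` under `(r, x) ↦ r x`. Then `λ̂(ξ) = ∫
ν̂(ξ·x) dμ(x)`, and Cauchy–Schwarz bounds `|λ̂(ξ)|²` by an average of `|ν̂|²` over the push-forward
of `μ` under `x ↦ ξ·x`. A slab of width `1/|ξ|` meets a bounded set in about `|ξ|^(d-1)` balls of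
radius `1/|ξ|`, so that push-forward gives unit intervals mass `O(|ξ|^(d-1-a))`. The `L²` mass of
`ν̂` on `|v| ≲ |ξ|` is `O(|ξ|^(1-τ))`. The product is `|λ̂(ξ)|² = O(|ξ|^(d-a-τ))`
(`norm_sq_mhat_map_smul_le`). To pass from pointwise values of `ν̂` to local `L²` averages, `ν` is
multiplied by a Gaussian density, and all cutoffs are Gaussian so that the transforms are explicit.

Convolving `λ` with a Frostman measure on `Z` multiplies the transforms, which gives the Sobolev
bound. Sobolev exponent `d` means a transform in `L²`, hence support of positive volume
(`volume_pos_of_lintegral_norm_sq_mhat_lt_top`). A Sobolev exponent above `u` gives finite dyadic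
`u`-energy, hence a Frostman restriction and, by mass distribution, dimension at least `u`.

Frostman measures on Borel sets come from an `ℓ²` capacity. Hilbert space geometry makes the
capacity continuous along increasing sequences of arbitrary sets, so analytic sets are capacitable
from inside by compact sets; on a compact set a minimax argument turns positive capacity into a
measure of finite dyadic energy; and zero capacity forces zero Hausdorff measure of every larger
exponent. -/

/-! ### Minimal-norm points of convex sets -/

section HilbertSpace

open Filter Topology

variable {H : Type*} [NormedAddCommGroup H] [InnerProductSpace ℝ H]

/-- A nonempty complete convex set contains a point `v` with `‖v‖² ≤ ⟪v, w⟫` for all its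
points `w`, namely the point of smallest norm. -/
theorem exists_norm_sq_le_inner_of_convex {S : Set H} (hne : S.Nonempty) (hcomp : IsComplete S)
    (hconv : Convex ℝ S) : ∃ v ∈ S, ∀ w ∈ S, ‖v‖ ^ 2 ≤ inner ℝ v w := by
  obtain ⟨v, hv, hmin⟩ := exists_norm_eq_iInf_of_complete_convex hne hcomp hconv 0
  refine ⟨v, hv, fun w hw => ?_⟩
  have h := (norm_eq_iInf_iff_real_inner_le_zero hconv hv).1 hmin w hw
  rw [zero_sub, inner_neg_left, inner_sub_right, real_inner_self_eq_norm_sq] at h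
  linarith

/-- In a decreasing sequence of convex sets meeting a fixed ball, one can choose points that
move by geometrically small steps. -/
theorem exists_seq_of_antitone_convex [CompleteSpace H] {S : ℕ → Set H} (hS : Antitone S)
    (hconv : ∀ n, Convex ℝ (S n)) {c : ℝ} (hc : ∀ n, ∃ f ∈ S n, ‖f‖ ≤ c) {ε : ℝ} (hε : 0 < ε) :
    ∃ f : ℕ → H, (∀ n, f n ∈ S n) ∧ ‖f 0‖ ≤ c + ε ∧
      ∀ n, ‖f (n + 1) - f n‖ ≤ ε * (1 / 2) ^ n := by
  have hmin : ∀ n, ∃ v ∈ closure (S n), ∀ w ∈ closure (S n), ‖v‖ ^ 2 ≤ inner ℝ v w := fun n =>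
    exists_norm_sq_le_inner_of_convex (let ⟨f, hf, _⟩ := hc n; ⟨f, subset_closure hf⟩)
      isClosed_closure.isComplete (hconv n).closure
  choose g hg hgmin using hmin
  have hgle : ∀ n, ∀ w ∈ closure (S n), ‖g n‖ ≤ ‖w‖ := fun n w hw => by
    have h1 := hgmin n w hw
    have h2 := real_inner_le_norm (g n) w
    by_contra! h
    nlinarith [norm_nonneg w]
  have hgc : ∀ n, ‖g n‖ ≤ c := fun n => by
    obtain ⟨f, hf, hfc⟩ := hc n
    exact (hgle n f (subset_closure hf)).trans hfc
  -- Minimality of `g n` gives `⟪g n, g m⟫ ≥ ‖g n‖²`, so the bounded increasing sequence of squared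
  -- norms controls distances and `g` is Cauchy.
  have hgdist : ∀ n m, n ≤ m → ‖g m - g n‖ ^ 2 ≤ ‖g m‖ ^ 2 - ‖g n‖ ^ 2 := fun n m hnm => by
    have h1 := hgmin n (g m) (closure_mono (hS hnm) (hg m))
    rw [norm_sub_sq_real, real_inner_comm]
    linarith
  have hmono : Monotone fun n => ‖g n‖ ^ 2 := fun n m hnm => by
    have := hgdist n m hnm
    have := sq_nonneg ‖g m - g n‖
    dsimp only
    linarith
  have hbdd : BddAbove (Set.range fun n => ‖g n‖ ^ 2) := by
    refine ⟨c ^ 2, ?_⟩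
    rintro _ ⟨n, rfl⟩
    exact pow_le_pow_left₀ (norm_nonneg _) (hgc n) 2
  have hcau : CauchySeq g := by
    have h1 := (tendsto_atTop_ciSup hmono hbdd).cauchySeq
    rw [Metric.cauchySeq_iff'] at h1 ⊢
    intro δ hδ
    obtain ⟨N, hN⟩ := h1 (δ ^ 2) (by positivity)
    refine ⟨N, fun n hn => ?_⟩
    have h2 := hN n hn
    rw [Real.dist_eq] at h2
    rw [dist_eq_norm]
    have h3 := hgdist N n hn
    exact lt_of_pow_lt_pow_left₀ 2 hδ.le (lt_of_le_of_lt h3 (lt_of_le_of_lt (le_abs_self _) h2))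
  -- The minimisers lie only in the closures, so points of the sets themselves are chosen near a
  -- fast subsequence. The three errors add up to `(1/4 + 1/4 + 1/8) ε 2⁻ⁿ`, below the allowed `ε
  -- 2⁻ⁿ`.
  obtain ⟨φ, hφ, hφg⟩ := hcau.subseq_mem
    (V := fun k => {p : H × H | dist p.1 p.2 < ε / 4 * (1 / 2) ^ k})
    (fun k => Metric.dist_mem_uniformity (by positivity))
  have hf : ∀ k, ∃ f ∈ S (φ k), dist (g (φ k)) f < ε / 4 * (1 / 2) ^ k := fun k =>
    Metric.mem_closure_iff.1 (hg (φ k)) _ (by positivity)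
  choose f hfS hfg using hf
  refine ⟨f, fun n => hS (hφ.id_le n) (hfS n), ?_, fun n => ?_⟩
  · have h1 := hfg 0
    rw [dist_eq_norm, norm_sub_rev] at h1
    have h2 : ‖f 0‖ ≤ ‖g (φ 0)‖ + ‖f 0 - g (φ 0)‖ := by
      simpa using norm_add_le (g (φ 0)) (f 0 - g (φ 0))
    have h3 := hgc (φ 0)
    norm_num at h1
    linarith
  · rw [← dist_eq_norm]
    have h1 : dist (g (φ (n + 1))) (g (φ n)) < ε / 4 * (1 / 2) ^ n := hφg n
    have h2 := hfg n
    have h3 := hfg (n + 1)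
    have h4 := dist_triangle4 (f (n + 1)) (g (φ (n + 1))) (g (φ n)) (f n)
    rw [dist_comm (f (n + 1)) (g _)] at h4
    have h5 : (0 : ℝ) < (1 / 2) ^ n := by positivity
    rw [pow_succ] at h3
    nlinarith

end HilbertSpace

/-! ### An `ℓ²` capacity and capacitability of analytic sets -/

section Capacity

open Filter Topology
open scoped NNReal

variable {X ι : Type*}

/-- The non-negative square-summable `f` for which the potential `∑ f i * φ i` exceeds `1`
on `A`. -/
def admissible (φ : ι → X → ℝ≥0) (A : Set X) : Set (lp (fun _ : ι => ℝ) 2) :=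
  {f | (∀ i, 0 ≤ f i) ∧ ∀ x ∈ A, 1 < ∑' i, ENNReal.ofReal (f i) * φ i x}

theorem admissible_anti {φ : ι → X → ℝ≥0} {A B : Set X} (h : A ⊆ B) :
    admissible φ B ⊆ admissible φ A :=
  fun _ hf => ⟨hf.1, fun x hx => hf.2 x (h hx)⟩

theorem convex_admissible (φ : ι → X → ℝ≥0) (A : Set X) : Convex ℝ (admissible φ A) := by
  rintro f ⟨hf0, hf⟩ g ⟨hg0, hg⟩ a b ha hb hab
  refine ⟨fun i => ?_, fun x hx => ?_⟩
  · have h1 := hf0 i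
    have h2 := hg0 i
    change 0 ≤ a * f i + b * g i
    positivity
  · have key : ∑' i, ENNReal.ofReal ((a • f + b • g) i) * φ i x
        = ENNReal.ofReal a * ∑' i, ENNReal.ofReal (f i) * φ i x
          + ENNReal.ofReal b * ∑' i, ENNReal.ofReal (g i) * φ i x := by
      rw [← ENNReal.tsum_mul_left, ← ENNReal.tsum_mul_left, ← ENNReal.tsum_add]
      refine tsum_congr fun i => ?_
      have : (a • f + b • g) i = a * f i + b * g i := rfl
      rw [this, ENNReal.ofReal_add (mul_nonneg ha (hf0 i)) (mul_nonneg hb (hg0 i)),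
        ENNReal.ofReal_mul ha, ENNReal.ofReal_mul hb, add_mul, mul_assoc, mul_assoc]
    rw [key]
    have hab' : ENNReal.ofReal a + ENNReal.ofReal b = 1 := by
      rw [← ENNReal.ofReal_add ha hb, hab, ENNReal.ofReal_one]
    -- Strictness has to come from a summand of positive weight, so the endpoint `a = 0` is
    -- separate.
    rcases ha.eq_or_lt with rfl | ha'
    · have hb1 : b = 1 := by linarith
      simpa [hb1] using hg x hx
    · calc (1 : ℝ≥0∞) = ENNReal.ofReal a * 1 + ENNReal.ofReal b * 1 := by simp [hab']
        _ < _ := ENNReal.add_lt_add_of_lt_of_le (by simp)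
          ((ENNReal.mul_lt_mul_iff_right (by simpa using ha') (by simp)).2 (hf x hx))
          (mul_le_mul_right (hg x hx).le _)

/-- The coordinatewise absolute value on `ℓ²`. -/
def lpAbs (f : lp (fun _ : ι => ℝ) 2) : lp (fun _ : ι => ℝ) 2 :=
  ⟨fun i => |f i|, by
    have h := (memℓp_gen_iff (p := 2) (by norm_num)).1 f.2
    exact (memℓp_gen_iff (p := 2) (by norm_num)).2 (by simpa using h)⟩

theorem lpAbs_apply (f : lp (fun _ : ι => ℝ) 2) (i : ι) : lpAbs f i = |f i| := rfl

theorem norm_lpAbs (f : lp (fun _ : ι => ℝ) 2) : ‖lpAbs f‖ = ‖f‖ := by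
  rw [lp.norm_eq_tsum_rpow (by norm_num), lp.norm_eq_tsum_rpow (by norm_num)]
  simp [lpAbs_apply]

/-- Continuity of the capacity `inf ‖f‖` along increasing sequences of arbitrary sets. -/
theorem exists_admissible_iUnion {φ : ι → X → ℝ≥0} {A : ℕ → Set X} (hA : Monotone A) {c : ℝ}
    (hc : ∀ n, ∃ f ∈ admissible φ (A n), ‖f‖ ≤ c) {ε : ℝ} (hε : 0 < ε) :
    ∃ f ∈ admissible φ (⋃ n, A n), ‖f‖ ≤ c + ε := by
  obtain ⟨f, hfS, hf0, hfd⟩ := exists_seq_of_antitone_convex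
    (fun n m hnm => admissible_anti (hA hnm)) (fun n => convex_admissible φ (A n)) hc
    (show 0 < ε / 3 by positivity)
  have hgeom : HasSum (fun n : ℕ => ε / 3 * (1 / 2 : ℝ) ^ n) (ε / 3 * 2) :=
    hasSum_geometric_two.mul_left _
  set D : ℕ → lp (fun _ : ι => ℝ) 2 := fun n => lpAbs (f (n + 1) - f n) with hD
  have hDle : ∀ n, ‖D n‖ ≤ ε / 3 * (1 / 2) ^ n := fun n => by rw [hD, norm_lpAbs]; exact hfd n
  have hDs : Summable D := Summable.of_norm_bounded hgeom.summable hDle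
  have hDn : ‖∑' n, D n‖ ≤ ε / 3 * 2 := tsum_of_norm_bounded hgeom hDle
  have hDi : ∀ i, HasSum (fun n => D n i) ((∑' n, D n) i) := fun i =>
    hDs.hasSum.map ((lp.evalCLM ℝ (fun _ : ι => ℝ) 2 i : _ →L[ℝ] ℝ))
      (lp.evalCLM ℝ (fun _ : ι => ℝ) 2 i).continuous
  have hge : ∀ n i, f n i ≤ f 0 i + (∑' n, D n) i := fun n i => by
    have h1 : ∑ k ∈ Finset.range n, D k i ≤ (∑' n, D n) i :=
      sum_le_hasSum _ (fun k _ => by rw [hD, lpAbs_apply]; exact abs_nonneg _) (hDi i)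
    have h2 : f n i - f 0 i = ∑ k ∈ Finset.range n, (f (k + 1) i - f k i) :=
      (Finset.sum_range_sub (fun k => f k i) n).symm
    have h3 : ∑ k ∈ Finset.range n, (f (k + 1) i - f k i) ≤ ∑ k ∈ Finset.range n, D k i :=
      Finset.sum_le_sum fun k _ => le_abs_self _
    linarith
  -- Adding the absolute increments to `f 0` dominates every `f n` coordinatewise, so this single
  -- function is admissible for all `A n` at once. Its norm is at most `(c + ε/3) + 2ε/3`.
  refine ⟨f 0 + ∑' n, D n, ⟨fun i => ((hfS 0).1 i).trans (hge 0 i), ?_⟩, ?_⟩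
  · intro x hx
    obtain ⟨n, hn⟩ := Set.mem_iUnion.1 hx
    refine ((hfS n).2 x hn).trans_le (ENNReal.tsum_le_tsum fun i => ?_)
    exact mul_le_mul_left (ENNReal.ofReal_le_ofReal (hge n i)) _
  · have := norm_add_le (f 0) (∑' n, D n)
    linarith

/-- A sum of non-negative continuous functions is lower semicontinuous. The strict inequality in
`admissible` is there for this: a function admissible on a compact set is admissible on a
neighbourhood of it. -/
theorem isOpen_potential_gt [TopologicalSpace X] {φ : ι → X → ℝ≥0} (hφ : ∀ i, Continuous (φ i))
    (f : ι → ℝ) : IsOpen {x | 1 < ∑' i, ENNReal.ofReal (f i) * φ i x} := by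
  refine (lowerSemicontinuous_tsum fun i => Continuous.lowerSemicontinuous ?_).isOpen_preimage 1
  exact (ENNReal.continuous_const_mul (by simp)).comp
    (ENNReal.continuous_coe.comp (hφ i))

/-- A compact box in Baire space contained in an open set has a finite-stage box contained in
that open set. -/
theorem exists_prefix_box_subset {n : ℕ → ℕ} {U : Set (ℕ → ℕ)} (hU : IsOpen U)
    (h : {σ : ℕ → ℕ | ∀ i, σ i ≤ n i} ⊆ U) : ∃ m, {σ : ℕ → ℕ | ∀ i < m, σ i ≤ n i} ⊆ U := by
  by_contra! hcon
  have hσ : ∀ m, ∃ σ : ℕ → ℕ, (∀ i < m, σ i ≤ n i) ∧ σ ∉ U := fun m => by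
    obtain ⟨σ, h1, h2⟩ := Set.not_subset.1 (hcon m)
    exact ⟨σ, h1, h2⟩
  choose σ hσ1 hσ2 using hσ
  have hK : IsCompact {σ : ℕ → ℕ | ∀ i, σ i ≤ n i} := by
    have : {σ : ℕ → ℕ | ∀ i, σ i ≤ n i} = Set.univ.pi fun i => Set.Iic (n i) := by
      ext; simp [Pi.le_def]
    rw [this]
    exact isCompact_univ_pi fun i => (Set.finite_Iic (n i)).isCompact
  -- Truncating `σ m` puts it in the compact box without changing coordinates below `m`; hence the
  -- truncated and the original sequences have the same coordinatewise limits along `ψ`.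
  obtain ⟨τ, hτ, ψ, hψ, hlim⟩ := hK.tendsto_subseq
    (x := fun m i => min (σ m i) (n i)) (fun m i => min_le_right _ _)
  have hlim' : Tendsto (fun k => σ (ψ k)) atTop (𝓝 τ) := by
    rw [tendsto_pi_nhds] at hlim ⊢
    intro i
    refine (hlim i).congr' ?_
    filter_upwards [eventually_gt_atTop i] with k hk
    exact min_eq_left (hσ1 (ψ k) i (hk.trans_le (hψ.id_le k)))
  obtain ⟨k, hk⟩ := (hlim'.eventually (hU.mem_nhds (h hτ))).exists
  exact hσ2 _ hk

/-- Capacitability of analytic sets. -/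
theorem AnalyticSet.exists_isCompact_le_norm_admissible [TopologicalSpace X]
    {φ : ι → X → ℝ≥0} (hφ : ∀ i, Continuous (φ i)) {A : Set X} (hA : AnalyticSet A) {c c' : ℝ}
    (hcc : c < c') (hc0 : 0 < c) (hc : ∀ f ∈ admissible φ A, c' ≤ ‖f‖) :
    ∃ K ⊆ A, IsCompact K ∧ ∀ f ∈ admissible φ K, c ≤ ‖f‖ := by
  rw [AnalyticSet] at hA
  rcases hA with rfl | ⟨F, hF, rfl⟩
  · have : (0 : lp (fun _ : ι => ℝ) 2) ∈ admissible φ (∅ : Set X) :=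
      ⟨fun i => le_rfl, fun x hx => hx.elim⟩
    have := hc 0 this
    rw [norm_zero] at this
    linarith
  set box : ℕ → (ℕ → ℕ) → Set (ℕ → ℕ) := fun m n => {σ | ∀ i < m, σ i ≤ n i} with hbox
  let P : ℕ → (ℕ → ℕ) → ℝ → Prop := fun m n b =>
    ∀ f ∈ admissible φ (F '' box m n), b < ‖f‖
  -- Bounding the `m`-th coordinate by `k` exhausts the current set as `k` grows, so by continuity
  -- of capacity some `k` loses arbitrarily little.
  have step : ∀ m n b, c < b → P m n b → ∀ b', b' < b → ∃ k, P (m + 1) (Function.update n m k) b' := by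
    intro m n b hb hP b' hb'
    by_contra! hcon
    have hcon' : ∀ k, ∃ f ∈ admissible φ (F '' box (m + 1) (Function.update n m k)),
        ‖f‖ ≤ b' := fun k => by
      have := hcon k
      simp only [P] at this
      push Not at this
      exact this
    have hmono : Monotone fun k => F '' box (m + 1) (Function.update n m k) := by
      intro k l hkl
      refine Set.image_mono fun σ hσ i hi => (hσ i hi).trans ?_
      rcases eq_or_ne i m with rfl | hne
      · simpa using hkl
      · simp [Function.update_of_ne hne]
    obtain ⟨f, hf, hfn⟩ := exists_admissible_iUnion hmono hcon' (show 0 < b - b' by linarith)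
    have hsub : F '' box m n ⊆ ⋃ k, F '' box (m + 1) (Function.update n m k) := by
      rintro _ ⟨σ, hσ, rfl⟩
      refine Set.mem_iUnion.2 ⟨σ m, σ, fun i hi => ?_, rfl⟩
      rcases eq_or_ne i m with rfl | hne
      · simp
      · rw [Function.update_of_ne hne]
        exact hσ i (by omega)
    have := hP f (admissible_anti hsub hf)
    linarith
  -- A decreasing budget that stays above `c`; it starts at the midpoint, below `c'`, because `P`
  -- asks for strict inequality.
  set b : ℕ → ℝ := fun m => c + (c' - c) / 2 * (1 / 2) ^ m with hb
  have hbc : ∀ m, c < b m := fun m => by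
    have : 0 < (c' - c) / 2 * (1 / 2 : ℝ) ^ m := mul_pos (by linarith) (by positivity)
    simp only [hb]; linarith
  have hbs : ∀ m, b (m + 1) < b m := fun m => by
    have : 0 < (c' - c) / 2 * (1 / 2 : ℝ) ^ m := mul_pos (by linarith) (by positivity)
    simp only [hb, pow_succ]; linarith
  have hP0 : P 0 0 (b 0) := by
    intro f hf
    have h1 : F '' box 0 0 = Set.range F := by simp [hbox]
    rw [h1] at hf
    have := hc f hf
    simp only [hb, pow_zero]
    linarith
  have hstep : ∀ m (n : {n // P m n (b m)}), ∃ n' : {n // P (m + 1) n (b (m + 1))},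
      ∀ i < m, n'.1 i = n.1 i := fun m n => by
    obtain ⟨k, hk⟩ := step m n.1 (b m) (hbc m) n.2 (b (m + 1)) (hbs m)
    exact ⟨⟨_, hk⟩, fun i hi => Function.update_of_ne (by omega) _ _⟩
  choose nxt hnxt using hstep
  let g : (m : ℕ) → {n // P m n (b m)} := fun m => Nat.rec ⟨0, hP0⟩ nxt m
  have hg : ∀ m i, i < m → (g (m + 1)).1 i = (g m).1 i := fun m i hi => hnxt m (g m) i hi
  have hg' : ∀ m i, i < m → (g m).1 i = (g (i + 1)).1 i := by
    intro m i hi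
    induction m, (show i + 1 ≤ m from hi) using Nat.le_induction with
    | base => rfl
    | succ m hm ih => rw [hg m i (by omega), ih (by omega)]
  -- Coordinate `i` is frozen from stage `i + 1` on, so the diagonal agrees with stage `m` below
  -- `m`.
  set n : ℕ → ℕ := fun i => (g (i + 1)).1 i with hn
  refine ⟨F '' {σ | ∀ i, σ i ≤ n i}, Set.image_subset_range _ _, ?_, ?_⟩
  · have : {σ : ℕ → ℕ | ∀ i, σ i ≤ n i} = Set.univ.pi fun i => Set.Iic (n i) := by
      ext; simp [Pi.le_def]
    rw [this]
    exact (isCompact_univ_pi fun i => (Set.finite_Iic (n i)).isCompact).image hF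
  · intro f hf
    -- A function admissible for the limiting compact image is already admissible for some finite
    -- stage, where the norm bound `b m` is known.
    obtain ⟨m, hm⟩ := exists_prefix_box_subset (n := n)
      ((isOpen_potential_gt hφ f).preimage hF) (fun σ hσ => hf.2 _ ⟨σ, hσ, rfl⟩)
    have h1 := (g m).2 f ⟨hf.1, ?_⟩
    · exact (hbc m).le.trans h1.le
    · rintro _ ⟨σ, hσ, rfl⟩
      exact hm fun i hi => (hσ i hi).trans (hg' m i hi).le

end Capacity

/-! ### Minimax: from capacity to a measure on a compact space -/

section Duality

open Filter Topology
open scoped NNReal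

variable {Y ι : Type*} [TopologicalSpace Y] [CompactSpace Y] [MeasurableSpace Y] [BorelSpace Y]

theorem ProbabilityMeasure.continuous_integral_coe {φ : Y → ℝ≥0} (hφ : Continuous φ) :
    Continuous fun μ : ProbabilityMeasure Y => ∫ y, (φ y : ℝ) ∂(μ : Measure Y) := by
  rw [continuous_iff_continuousAt]
  intro μ
  exact (ProbabilityMeasure.tendsto_iff_forall_integral_tendsto.1 tendsto_id)
    (BoundedContinuousFunction.mkOfCompact ⟨fun y => (φ y : ℝ), by fun_prop⟩)

/-- The vectors `(∫ φ i dμ)` for `i ∈ F` form a compact convex set. If `v` is its point of least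
norm, testing against Dirac masses gives `‖v‖² ≤ ∑ v i * φ i x` for every `x`. Thus `t v / ‖v‖²` is
admissible for each `t > 1`, so `c ≤ t / ‖v‖`, and `t → 1` yields `‖v‖ ≤ 1 / c`. -/
theorem exists_probabilityMeasure_finset_sum_sq_le [T2Space Y] [Nonempty Y] {φ : ι → Y → ℝ≥0} (hφ : ∀ i, Continuous (φ i))
    {c : ℝ} (hc0 : 0 < c) (hc : ∀ f ∈ admissible φ Set.univ, c ≤ ‖f‖) (F : Finset ι) :
    ∃ μ : ProbabilityMeasure Y, ∑ i ∈ F, (∫ y, (φ i y : ℝ) ∂(μ : Measure Y)) ^ 2 ≤ 1 / c ^ 2 := by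
  classical
  let V : ProbabilityMeasure Y → EuclideanSpace ℝ F :=
    fun μ => WithLp.toLp 2 fun i => ∫ y, (φ i y : ℝ) ∂(μ : Measure Y)
  have hVc : Continuous V := by
    refine (PiLp.continuous_toLp 2 _).comp (continuous_pi fun i => ?_)
    exact ProbabilityMeasure.continuous_integral_coe (hφ i)
  have hint : ∀ (i : ι) (μ : Measure Y) [IsFiniteMeasure μ], Integrable (fun y => (φ i y : ℝ)) μ :=
    fun i μ _ => (NNReal.continuous_coe.comp (hφ i)).integrable_of_hasCompactSupport
      (HasCompactSupport.of_compactSpace _)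
  have hconv : Convex ℝ (Set.range V) := by
    rintro _ ⟨μ, rfl⟩ _ ⟨ν, rfl⟩ a b ha hb hab
    lift a to ℝ≥0 using ha
    lift b to ℝ≥0 using hb
    have hab' : a + b = 1 := by exact_mod_cast hab
    refine ⟨⟨a • (μ : Measure Y) + b • (ν : Measure Y), ⟨?_⟩⟩, ?_⟩
    · simp only [Measure.coe_add, Measure.coe_smul, Pi.add_apply, Pi.smul_apply, measure_univ]
      simp only [ENNReal.smul_def, smul_eq_mul, mul_one]
      exact_mod_cast hab'
    · ext i
      simp only [V, ProbabilityMeasure.coe_mk, PiLp.add_apply, PiLp.smul_apply, smul_eq_mul]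
      rw [integral_add_measure (hint _ _) (hint _ _), integral_smul_nnreal_measure,
        integral_smul_nnreal_measure]
      simp [NNReal.smul_def]
  have hne : Nonempty (ProbabilityMeasure Y) :=
    ⟨⟨Measure.dirac (Classical.arbitrary Y), inferInstance⟩⟩
  obtain ⟨_, ⟨μ, rfl⟩, hμ⟩ := exists_norm_sq_le_inner_of_convex (Set.range_nonempty V)
    (isCompact_range hVc).isComplete hconv
  refine ⟨μ, ?_⟩
  have hnorm : ‖V μ‖ ^ 2 = ∑ i ∈ F, (∫ y, (φ i y : ℝ) ∂(μ : Measure Y)) ^ 2 := by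
    rw [EuclideanSpace.norm_sq_eq, ← Finset.sum_coe_sort F]
    simp [V]
  rw [← hnorm]
  rcases (norm_nonneg (V μ)).eq_or_lt with h0 | hpos
  · rw [← h0, zero_pow two_ne_zero]; positivity
  suffices h : ∀ t : ℝ, 1 < t → c ≤ t / ‖V μ‖ by
    have h1 : c ≤ 1 / ‖V μ‖ := by
      refine le_of_forall_gt_imp_ge_of_dense fun b hb => ?_
      have := h (b * ‖V μ‖) (by rwa [div_lt_iff₀ hpos] at hb)
      rwa [mul_div_cancel_right₀ _ hpos.ne'] at this
    rw [le_div_iff₀ (by positivity), ← mul_pow]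
    rw [le_div_iff₀ hpos] at h1
    exact pow_le_one₀ (by positivity) (by linarith)
  intro t ht
  set v : ι → ℝ := fun i => ∫ y, (φ i y : ℝ) ∂(μ : Measure Y) with hv
  have hv0 : ∀ i, 0 ≤ v i := fun i => integral_nonneg fun y => NNReal.coe_nonneg _
  set s : ℝ := t / ‖V μ‖ ^ 2 with hs
  have hs0 : 0 < s := by positivity
  set f : lp (fun _ : ι => ℝ) 2 := ∑ i ∈ F, lp.single 2 i (s * v i) with hf
  have hfi : ∀ i, f i = if i ∈ F then s * v i else 0 := fun i => by
    rw [hf, lp.coeFn_sum, Finset.sum_apply]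
    simp [Pi.single_apply]
  have hfn : ‖f‖ = t / ‖V μ‖ := by
    have h1 := lp.norm_sum_single (p := 2) (by norm_num) (fun i => s * v i) F
    rw [← hf] at h1
    have h2 : ‖f‖ ^ 2 = (t / ‖V μ‖) ^ 2 := by
      have h3 : ‖f‖ ^ 2 = ∑ i ∈ F, (s * v i) ^ 2 := by simpa [← mul_pow, sq_abs, ← abs_mul] using h1
      rw [h3]
      simp_rw [mul_pow]
      rw [← Finset.mul_sum, ← hnorm, hs]
      field_simp
    exact (pow_left_inj₀ (norm_nonneg _) (by positivity) two_ne_zero).1 h2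
  rw [← hfn]
  refine hc f ⟨fun i => ?_, fun x _ => ?_⟩
  · rw [hfi]
    split_ifs
    · exact mul_nonneg hs0.le (hv0 i)
    · exact le_rfl
  · have h1 := hμ (V ⟨Measure.dirac x, inferInstance⟩) ⟨_, rfl⟩
    have h2 : inner ℝ (V μ) (V ⟨Measure.dirac x, inferInstance⟩) = ∑ i ∈ F, v i * φ i x := by
      rw [PiLp.inner_apply, ← Finset.sum_coe_sort F]
      refine Finset.sum_congr rfl fun i _ => ?_
      simp only [V, ProbabilityMeasure.coe_mk]
      rw [integral_dirac' (fun y => (φ i y : ℝ)) x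
        (NNReal.continuous_coe.comp (hφ i)).stronglyMeasurable]
      simp [hv, mul_comm]
    rw [h2] at h1
    have h3 : ∑' i, ENNReal.ofReal (f i) * φ i x
        = ENNReal.ofReal (s * ∑ i ∈ F, v i * φ i x) := by
      rw [tsum_eq_sum (s := F) (fun i hi => by simp [hfi, hi]), Finset.mul_sum,
        ENNReal.ofReal_sum_of_nonneg
          (fun i _ => mul_nonneg hs0.le (mul_nonneg (hv0 i) (NNReal.coe_nonneg _)))]
      refine Finset.sum_congr rfl fun i hi => ?_
      rw [hfi, if_pos hi, ← ENNReal.ofReal_coe_nnreal, ← ENNReal.ofReal_mul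
        (mul_nonneg hs0.le (hv0 i)), mul_assoc]
    rw [h3, ← ENNReal.ofReal_one, ENNReal.ofReal_lt_ofReal_iff_of_nonneg zero_le_one]
    calc (1 : ℝ) < t := ht
      _ = s * ‖V μ‖ ^ 2 := by rw [hs]; field_simp
      _ ≤ _ := by gcongr

/-- The constraints for the various `F` are closed and nested in the weakly compact space of
probability measures, so one measure satisfies all of them. -/
theorem exists_probabilityMeasure_sum_sq_le [T2Space Y] [Nonempty Y] {φ : ι → Y → ℝ≥0} (hφ : ∀ i, Continuous (φ i))
    {c : ℝ} (hc0 : 0 < c) (hc : ∀ f ∈ admissible φ Set.univ, c ≤ ‖f‖) :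
    ∃ μ : ProbabilityMeasure Y, ∀ F : Finset ι,
      ∑ i ∈ F, (∫ y, (φ i y : ℝ) ∂(μ : Measure Y)) ^ 2 ≤ 1 / c ^ 2 := by
  classical
  let S : Finset ι → Set (ProbabilityMeasure Y) := fun F =>
    {μ | ∑ i ∈ F, (∫ y, (φ i y : ℝ) ∂(μ : Measure Y)) ^ 2 ≤ 1 / c ^ 2}
  have hcl : ∀ F, IsClosed (S F) := fun F =>
    isClosed_le (continuous_finsetSum _ fun i _ =>
      (ProbabilityMeasure.continuous_integral_coe (hφ i)).pow 2) continuous_const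
  have hanti : Antitone S := fun F G hFG μ hμ =>
    le_trans (Finset.sum_le_sum_of_subset_of_nonneg hFG fun i _ _ => sq_nonneg
      (∫ y, (φ i y : ℝ) ∂(μ : Measure Y))) hμ
  obtain ⟨μ, hμ⟩ := IsCompact.nonempty_iInter_of_directed_nonempty_isCompact_isClosed S
    hanti.directed_ge (fun F => exists_probabilityMeasure_finset_sum_sq_le hφ hc0 hc F)
    (fun F => (hcl F).isCompact) hcl
  exact ⟨μ, fun F => Set.mem_iInter.1 hμ F⟩

end Duality

/-! ### Dyadic bumps, and zero capacity versus Hausdorff measure -/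

section Lattice

open Filter Topology
open scoped NNReal

variable {V : Type*} [NormedAddCommGroup V] [NormedSpace ℝ V]

/-- A finite-dimensional space contains a countable set that is `ρ`-dense and of bounded
multiplicity at the scale `ρ + 2`. -/
theorem exists_countable_net (V : Type*) [NormedAddCommGroup V] [NormedSpace ℝ V]
    [FiniteDimensional ℝ V] : ∃ (L : Set V) (ρ : ℝ) (M : ℕ), 0 ≤ ρ ∧ 0 < M ∧ L.Countable ∧
      (∀ x : V, ∃ n : L, ‖x - n‖ ≤ ρ) ∧
      ∀ x : V, ∃ S : Finset L, S.card ≤ M ∧ ∀ n : L, ‖x - n‖ < ρ + 2 → n ∈ S := by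
  classical
  set b := Module.finBasis ℝ V with hb
  have : ProperSpace V := FiniteDimensional.proper ℝ V
  set L := Submodule.span ℤ (Set.range b) with hL
  set ρ := ∑ i, ‖b i‖ with hρ
  have hρ0 : 0 ≤ ρ := Finset.sum_nonneg fun i _ => norm_nonneg _
  have hdense : ∀ x, ‖x - (ZSpan.floor b x : V)‖ ≤ ρ := fun x => by
    rw [← ZSpan.fract_apply]
    exact ZSpan.norm_fract_le b x
  have hfin : (Metric.ball (0 : V) (2 * ρ + 2) ∩ (L : Set V)).Finite :=
    ZSpan.setFinite_inter b Metric.isBounded_ball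
  have hfin' : {n : L | ‖(n : V)‖ < 2 * ρ + 2}.Finite := by
    refine Set.Finite.of_finite_image (f := ((↑) : L → V)) (hfin.subset ?_)
      Subtype.val_injective.injOn
    rintro _ ⟨n, hn, rfl⟩
    exact ⟨by simpa using hn, n.2⟩
  have hcount : Countable L := inferInstance
  refine ⟨L, ρ, hfin'.toFinset.card + 1, hρ0, by omega, Set.countable_coe_iff.1 hcount,
    fun x => ⟨_, hdense x⟩, fun x => ?_⟩
  -- Translating by the lattice point next to `x`, at distance at most `ρ`, reduces the count to the
  -- ball of radius `ρ + (ρ + 2)` at the origin, uniformly in `x`.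
  refine ⟨hfin'.toFinset.image fun n => ZSpan.floor b x + n, Finset.card_image_le.trans (by omega),
    fun n hn => ?_⟩
  refine Finset.mem_image.2 ⟨(n : L) - ZSpan.floor b x, ?_, by simp⟩
  rw [Set.Finite.mem_toFinset]
  have h1 := hdense x
  calc ‖((n : L) : V) - ZSpan.floor b x‖
      = ‖(x - (ZSpan.floor b x : V)) - (x - n)‖ := by congr 1; abel
    _ ≤ ‖x - (ZSpan.floor b x : V)‖ + ‖x - n‖ := norm_sub_le _ _
    _ < 2 * ρ + 2 := by linarith

/-- The bump of height at most `(ρ + 2) * w ^ k` around the point `2⁻ᵏ n`. -/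
noncomputable def netBump (L : Set V) (ρ w : ℝ) (p : ℕ × L) (x : V) : ℝ≥0 :=
  Real.toNNReal (w ^ p.1 * max 0 (ρ + 2 - ‖(2 : ℝ) ^ p.1 • x - p.2‖))

theorem continuous_netBump (L : Set V) (ρ w : ℝ) (p : ℕ × L) : Continuous (netBump L ρ w p) := by
  unfold netBump
  fun_prop

/-- Pigeonhole over scales. If all coefficients near `x` were below the threshold, level `k`, with
at most `M` bumps of height at most `(ρ + 2) w ^ k`, would contribute at most `(1 - w q) (w q) ^ k`;
these sum to `1`, too little for a potential exceeding `1`. -/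
theorem exists_large_coefficient {L : Set V} {ρ : ℝ} {M : ℕ} (hρ : 0 ≤ ρ) (hM : 0 < M) {x : V}
    (hS : ∀ x : V, ∃ S : Finset L, S.card ≤ M ∧ ∀ n : L, ‖x - n‖ < ρ + 2 → n ∈ S)
    {w q : ℝ} (hw : 0 < w) (hq : 0 < q) (hwq : w * q < 1) {f : ℕ × L → ℝ} (hf : ∀ p, 0 ≤ f p)
    (hx : 1 < ∑' p, ENNReal.ofReal (f p) * netBump L ρ w p x) :
    ∃ p : ℕ × L, ‖(2 : ℝ) ^ p.1 • x - p.2‖ < ρ + 2 ∧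
      (1 - w * q) / (M * (ρ + 2)) * q ^ p.1 ≤ f p := by
  by_contra! hcon
  set c := (1 - w * q) / (M * (ρ + 2)) with hc
  have hM' : (0 : ℝ) < M := by exact_mod_cast hM
  have hc0 : 0 < c := div_pos (by linarith) (by positivity)
  have hterm : ∀ k, ∑' n : L, ENNReal.ofReal (f (k, n)) * netBump L ρ w (k, n) x
      ≤ ENNReal.ofReal ((1 - w * q) * (w * q) ^ k) := by
    intro k
    obtain ⟨S, hSM, hS⟩ := hS ((2 : ℝ) ^ k • x)
    rw [tsum_eq_sum (s := S)]
    · calc ∑ n ∈ S, ENNReal.ofReal (f (k, n)) * netBump L ρ w (k, n) x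
          ≤ ∑ n ∈ S, ENNReal.ofReal (c * q ^ k * (w ^ k * (ρ + 2))) := by
            refine Finset.sum_le_sum fun n _ => ?_
            rw [netBump, ← ENNReal.ofReal, ← ENNReal.ofReal_mul (hf _)]
            refine ENNReal.ofReal_le_ofReal ?_
            by_cases h : ‖(2 : ℝ) ^ k • x - n‖ < ρ + 2
            · have h1 := (hcon (k, n) h).le
              have h2 : max 0 (ρ + 2 - ‖(2 : ℝ) ^ k • x - n‖) ≤ ρ + 2 :=
                max_le (by linarith) (by linarith [norm_nonneg ((2 : ℝ) ^ k • x - n)])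
              have h3 : (0 : ℝ) ≤ max 0 (ρ + 2 - ‖(2 : ℝ) ^ k • x - n‖) := le_max_left _ _
              have h4 := hf (k, n)
              dsimp only at h1 ⊢
              gcongr
            · have : max 0 (ρ + 2 - ‖(2 : ℝ) ^ k • x - n‖) = 0 := max_eq_left (by linarith)
              dsimp only
              rw [this]
              simp only [mul_zero]
              positivity
        _ = S.card * ENNReal.ofReal (c * q ^ k * (w ^ k * (ρ + 2))) := by simp
        _ ≤ M * ENNReal.ofReal (c * q ^ k * (w ^ k * (ρ + 2))) := by gcongr
        _ = ENNReal.ofReal ((1 - w * q) * (w * q) ^ k) := by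
            rw [← ENNReal.ofReal_natCast, ← ENNReal.ofReal_mul (by positivity)]
            congr 1
            rw [hc, mul_pow]
            field_simp
    · intro n hn
      have : max 0 (ρ + 2 - ‖(2 : ℝ) ^ k • x - n‖) = 0 := by
        refine max_eq_left ?_
        by_contra! h
        exact hn (hS n (by linarith))
      simp [netBump, this]
  have hwq0 : 0 ≤ w * q := by positivity
  have : ∑' p, ENNReal.ofReal (f p) * netBump L ρ w p x ≤ 1 := by
    rw [ENNReal.tsum_prod']
    refine (ENNReal.tsum_le_tsum hterm).trans ?_
    rw [← ENNReal.ofReal_tsum_of_nonneg (fun k => mul_nonneg (by linarith) (by positivity))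
      ((summable_geometric_of_lt_one hwq0 hwq).mul_left _), tsum_mul_left,
      tsum_geometric_of_lt_one hwq0 hwq, mul_inv_cancel₀ (by linarith), ENNReal.ofReal_one]
  exact absurd hx (not_lt.2 this)

/-- A set of zero capacity for the bumps of weight `2 ^ (a / 2)` has zero Hausdorff measure of
every dimension `a' > a`. -/
theorem hausdorffMeasure_eq_zero_of_admissible [MeasurableSpace V] [BorelSpace V]
    {L : Set V} {ρ : ℝ} {M : ℕ} (hρ : 0 ≤ ρ) (hM : 0 < M) (hL : L.Countable)
    (hS : ∀ x : V, ∃ S : Finset L, S.card ≤ M ∧ ∀ n : L, ‖x - n‖ < ρ + 2 → n ∈ S)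
    {a a' : ℝ} (ha : 0 ≤ a) (haa : a < a') {E : Set V}
    (hE : ∀ ε : ℝ, 0 < ε → ∃ f ∈ admissible (netBump L ρ ((2 : ℝ) ^ (a / 2))) E, ‖f‖ ≤ ε) :
    Measure.hausdorffMeasure a' E = 0 := by
  classical
  have : Countable L := hL
  set w : ℝ := (2 : ℝ) ^ (a / 2) with hw
  -- With this `q` the square of the threshold `c q ^ k` is `c² (2⁻ᵏ)^a'`, so `f p ^ 2` pays for the
  -- `a'`-th power of a diameter at scale `k`; `w q < 1` is exactly `a < a'`.
  set q : ℝ := (2 : ℝ) ^ (-a' / 2) with hq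
  have hw0 : 0 < w := by positivity
  have hq0 : 0 < q := by positivity
  have hwq : w * q < 1 := by
    rw [hw, hq, ← Real.rpow_add two_pos]
    exact Real.rpow_lt_one_of_one_lt_of_neg one_lt_two (by linarith)
  have hq2 : ∀ k : ℕ, ((2 : ℝ) ^ k)⁻¹ ^ a' = (q ^ k) ^ 2 := fun k => by
    rw [hq, ← Real.rpow_natCast, ← Real.rpow_natCast, ← Real.rpow_natCast, ← Real.rpow_neg two_pos.le,
      ← Real.rpow_mul two_pos.le, ← Real.rpow_mul two_pos.le, ← Real.rpow_mul two_pos.le]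
    congr 1
    push_cast
    ring
  have hq3 : ∀ k : ℕ, ((2 : ℝ) ^ k)⁻¹ = (q ^ k) ^ (2 / a') := fun k => by
    rw [← Real.rpow_natCast q, ← Real.rpow_mul hq0.le, hq, ← Real.rpow_mul two_pos.le,
      ← Real.rpow_natCast, ← Real.rpow_neg two_pos.le]
    congr 1
    have : a' ≠ 0 := by linarith
    field_simp
  set c := (1 - w * q) / (M * (ρ + 2)) with hc
  have hM' : (0 : ℝ) < M := by exact_mod_cast hM
  have hc0 : 0 < c := div_pos (by linarith) (by positivity)
  have ha'0 : 0 < a' := by linarith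
  have hE' : ∀ m : ℕ, ∃ f ∈ admissible (netBump L ρ w) E, ‖f‖ ≤ 1 / ((m : ℝ) + 1) :=
    fun m => hE _ (by positivity)
  choose f hf hfn using hE'
  -- The cover consists of the balls whose coefficient passes the threshold. Since `‖f m‖ → 0`, such
  -- coefficients occur only at small scales, and the sum of `diam ^ a'` is `O(‖f m‖²)`.
  let t : ℕ → ℕ × L → Set V := fun m p =>
    if c * q ^ p.1 ≤ f m p then Metric.ball (((2 : ℝ) ^ p.1)⁻¹ • (p.2 : V))
      ((ρ + 2) * ((2 : ℝ) ^ p.1)⁻¹) else ∅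
  have hediam : ∀ m p, c * q ^ p.1 ≤ f m p →
      Metric.ediam (t m p) ≤ ENNReal.ofReal (2 * (ρ + 2) * ((2 : ℝ) ^ p.1)⁻¹) := by
    intro m p hp
    simp only [t, if_pos hp]
    rw [← Metric.eball_ofReal]
    refine Metric.ediam_eball_le.trans (le_of_eq ?_)
    rw [mul_assoc, ENNReal.ofReal_mul zero_le_two]
    simp
  have hlim : Tendsto (fun m : ℕ => 1 / ((m : ℝ) + 1)) atTop (𝓝 0) :=
    tendsto_one_div_add_atTop_nhds_zero_nat
  refine le_antisymm ?_ zero_le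
  refine (Measure.hausdorffMeasure_le_liminf_tsum a' E (l := atTop)
    (fun m : ℕ => ENNReal.ofReal (2 * (ρ + 2) * (1 / ((m : ℝ) + 1) / c) ^ (2 / a'))) ?_ t ?_ ?_).trans ?_
  · rw [← ENNReal.ofReal_zero]
    refine ENNReal.tendsto_ofReal ?_
    have h1 := ((hlim.div_const c).rpow_const (p := 2 / a')
      (Or.inr (by positivity))).const_mul (2 * (ρ + 2))
    rwa [zero_div, Real.zero_rpow (by positivity), mul_zero] at h1
  · refine Eventually.of_forall fun m p => ?_
    by_cases hp : c * q ^ p.1 ≤ f m p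
    · refine (hediam m p hp).trans (ENNReal.ofReal_le_ofReal ?_)
      rw [hq3]
      have h1 : q ^ p.1 ≤ 1 / ((m : ℝ) + 1) / c := by
        rw [le_div_iff₀ hc0, mul_comm]
        refine hp.trans (le_trans ?_ (hfn m))
        exact (le_abs_self _).trans (lp.norm_apply_le_norm two_ne_zero (f m) p)
      gcongr
    · simp [t, if_neg hp]
  · refine Eventually.of_forall fun m x hx => ?_
    obtain ⟨p, hp1, hp2⟩ := exists_large_coefficient hρ hM hS hw0 hq0 hwq (hf m).1 ((hf m).2 x hx)
    refine Set.mem_iUnion.2 ⟨p, ?_⟩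
    simp only [t]
    rw [if_pos hp2, Metric.mem_ball, dist_eq_norm]
    have h2 : (0 : ℝ) < 2 ^ p.1 := by positivity
    have h3 : x - ((2 : ℝ) ^ p.1)⁻¹ • (p.2 : V)
        = ((2 : ℝ) ^ p.1)⁻¹ • ((2 : ℝ) ^ p.1 • x - (p.2 : V)) := by
      rw [smul_sub, inv_smul_smul₀ h2.ne']
    rw [h3, norm_smul, Real.norm_of_nonneg (by positivity), mul_comm]
    gcongr
  · have hsum : ∀ m, ∑' p, Metric.ediam (t m p) ^ a'
        ≤ ENNReal.ofReal ((2 * (ρ + 2)) ^ a' / c ^ 2 * (1 / ((m : ℝ) + 1)) ^ 2) := by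
      intro m
      have hsq : HasSum (fun p => f m p ^ 2) (‖f m‖ ^ 2) := by
        have := lp.hasSum_norm (p := 2) (by norm_num) (f m)
        simpa using this
      calc ∑' p, Metric.ediam (t m p) ^ a'
          ≤ ∑' p, ENNReal.ofReal ((2 * (ρ + 2)) ^ a' / c ^ 2 * f m p ^ 2) := by
            refine ENNReal.tsum_le_tsum fun p => ?_
            by_cases hp : c * q ^ p.1 ≤ f m p
            · refine (ENNReal.rpow_le_rpow (hediam m p hp) ha'0.le).trans ?_
              rw [ENNReal.ofReal_rpow_of_nonneg (by positivity) ha'0.le]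
              refine ENNReal.ofReal_le_ofReal ?_
              rw [Real.mul_rpow (by positivity) (by positivity), hq2]
              have h1 : (c * q ^ p.1) ^ 2 ≤ f m p ^ 2 := by gcongr
              calc (2 * (ρ + 2)) ^ a' * (q ^ p.1) ^ 2
                  = (2 * (ρ + 2)) ^ a' / c ^ 2 * (c * q ^ p.1) ^ 2 := by field_simp
                _ ≤ _ := by gcongr
            · simp [t, if_neg hp, ha'0]
        _ = ENNReal.ofReal ((2 * (ρ + 2)) ^ a' / c ^ 2 * ‖f m‖ ^ 2) := by
            rw [← ENNReal.ofReal_tsum_of_nonneg (fun p => by positivity) (hsq.summable.mul_left _),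
              tsum_mul_left, hsq.tsum_eq]
        _ ≤ _ := by
            refine ENNReal.ofReal_le_ofReal ?_
            gcongr
            exact hfn m
    have hlim2 : Tendsto (fun m : ℕ => ENNReal.ofReal
        ((2 * (ρ + 2)) ^ a' / c ^ 2 * (1 / ((m : ℝ) + 1)) ^ 2)) atTop (𝓝 0) := by
      rw [← ENNReal.ofReal_zero]
      refine ENNReal.tendsto_ofReal ?_
      have h1 := (hlim.pow 2).const_mul ((2 * (ρ + 2)) ^ a' / c ^ 2)
      rwa [zero_pow two_ne_zero, mul_zero] at h1
    exact (liminf_le_liminf (Eventually.of_forall hsum)).trans hlim2.liminf_eq.le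

end Lattice

/-! ### Mass distribution and Frostman's lemma -/

section Frostman

open Filter Topology
open scoped NNReal

/-- The Frostman condition `μ (B(x, r)) ≤ C r ^ u`. -/
def IsFrostman {X : Type*} [PseudoMetricSpace X] [MeasurableSpace X] (μ : Measure X) (u : ℝ) :
    Prop :=
  ∃ C : ℝ, 0 ≤ C ∧ ∀ x r, 0 < r → μ (Metric.ball x r) ≤ ENNReal.ofReal (C * r ^ u)

/-- The mass distribution principle. -/
theorem IsFrostman.le_dimH {X : Type*} [MetricSpace X] [MeasurableSpace X] [BorelSpace X]
    {μ : Measure X} {u : ℝ} (hμ : IsFrostman μ u) (hu : 0 < u) {S : Set X} (hS : μ S ≠ 0) :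
    ENNReal.ofReal u ≤ dimH S := by
  obtain ⟨C, hC0, hC⟩ := hμ
  have hle : ∀ s : Set X, Metric.ediam s ≤ 1 →
      μ s ≤ ENNReal.ofReal (C + 1) * Metric.ediam s ^ u := by
    intro s hs
    rcases s.eq_empty_or_nonempty with rfl | ⟨x, hx⟩
    · simp
    have hfin : Metric.ediam s ≠ ∞ := (hs.trans_lt ENNReal.one_lt_top).ne
    set δ := (Metric.ediam s).toReal with hδ
    have hδ0 : 0 ≤ δ := ENNReal.toReal_nonneg
    -- Balls are open, so `s` fits only in radii exceeding its diameter; letting `r ↓ δ` also covers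
    -- diameter zero.
    have h1 : ∀ r, δ < r → μ s ≤ ENNReal.ofReal (C * r ^ u) := fun r hr => by
      refine le_trans (measure_mono fun y hy => ?_) (hC x r (hδ0.trans_lt hr))
      rw [Metric.mem_ball, dist_edist]
      exact lt_of_le_of_lt (ENNReal.toReal_mono hfin (Metric.edist_le_ediam_of_mem hy hx)) hr
    have h2 : Tendsto (fun r : ℝ => ENNReal.ofReal (C * r ^ u)) (𝓝[>] δ)
        (𝓝 (ENNReal.ofReal (C * δ ^ u))) := by
      refine ENNReal.tendsto_ofReal (Tendsto.const_mul _ ?_)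
      exact ((Real.continuousAt_rpow_const δ u (Or.inr hu.le)).tendsto).mono_left
        nhdsWithin_le_nhds
    have h3 : μ s ≤ ENNReal.ofReal (C * δ ^ u) :=
      ge_of_tendsto h2 (eventually_mem_nhdsWithin.mono fun r hr => h1 r hr)
    refine h3.trans ?_
    rw [ENNReal.ofReal_mul hC0, ← ENNReal.ofReal_rpow_of_nonneg hδ0 hu.le, hδ,
      ENNReal.ofReal_toReal hfin]
    gcongr
    linarith
  have hC1 : ENNReal.ofReal (C + 1) ≠ 0 := by simpa using (by linarith : 0 < C + 1)
  have hHaus : (ENNReal.ofReal (C + 1))⁻¹ • μ ≤ Measure.hausdorffMeasure u := by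
    refine Measure.le_hausdorffMeasure u _ 1 one_pos fun s hs => ?_
    rw [Measure.smul_apply, smul_eq_mul, mul_comm, ← div_eq_mul_inv]
    exact ENNReal.div_le_of_le_mul' (hle s hs)
  have hne : Measure.hausdorffMeasure u S ≠ 0 := by
    intro h0
    have h1 := hHaus S
    rw [h0, Measure.smul_apply, smul_eq_mul, nonpos_iff_eq_zero, mul_eq_zero] at h1
    exact h1.elim (fun h => ENNReal.inv_ne_zero.2 ENNReal.ofReal_ne_top h) hS
  have := le_dimH_of_hausdorffMeasure_ne_zero (d := u.toNNReal) (s := S)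
    (by rwa [Real.coe_toNNReal u hu.le])
  exact this

theorem measurable_measure_ball {X : Type*} [PseudoMetricSpace X] [SecondCountableTopology X]
    [MeasurableSpace X] [BorelSpace X] (μ : Measure X) [SFinite μ] (r : ℝ) :
    Measurable fun x => μ (Metric.ball x r) := by
  have h : MeasurableSet {p : X × X | dist p.2 p.1 < r} :=
    (isOpen_lt (by fun_prop) continuous_const).measurableSet
  exact measurable_measure_prodMk_left h

/-- If the dyadic `u`-energy of `μ` is finite, then `μ` restricts to a Frostman measure on a
compact set of positive measure. -/
theorem exists_isFrostman_restrict {X : Type*} [MetricSpace X] [SecondCountableTopology X]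
    [MeasurableSpace X] [BorelSpace X] {μ : Measure X} [IsFiniteMeasure μ] (hμ0 : μ ≠ 0)
    {u : ℝ} (hu : 0 ≤ u) {K : Set X} (hK : IsCompact K) (hμK : μ Kᶜ = 0)
    (h : ∑' k : ℕ, ENNReal.ofReal (((2 : ℝ) ^ u) ^ k) *
      ∫⁻ x, μ (Metric.ball x ((2 : ℝ) ^ k)⁻¹) ∂μ ≠ ∞) :
    ∃ K' ⊆ K, IsCompact K' ∧ μ K' ≠ 0 ∧ IsFrostman (μ.restrict K') u := by
  set g : X → ℝ≥0∞ := fun x =>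
    ∑' k : ℕ, ENNReal.ofReal (((2 : ℝ) ^ u) ^ k) * μ (Metric.ball x ((2 : ℝ) ^ k)⁻¹) with hg
  have hgm : Measurable g := Measurable.tsum fun k =>
    (measurable_measure_ball μ _).const_mul _
  have hgint : ∫⁻ x, g x ∂μ ≠ ∞ := by
    rw [hg, lintegral_tsum fun k => ((measurable_measure_ball μ _).const_mul _).aemeasurable]
    simp_rw [lintegral_const_mul _ (measurable_measure_ball μ _)]
    exact h
  have hae : ∀ᵐ x ∂μ, g x < ∞ := ae_lt_top hgm hgint
  have hM : ∃ M : ℕ, μ {x | g x ≤ M} ≠ 0 := by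
    by_contra! hcon
    have h1 : μ (⋃ M : ℕ, {x | g x ≤ M}) = 0 := measure_iUnion_null hcon
    have h2 : ∀ᵐ x ∂μ, False := by
      filter_upwards [hae, measure_eq_zero_iff_ae_notMem.1 h1] with x hx hx'
      obtain ⟨n, hn⟩ := ENNReal.exists_nat_gt hx.ne
      exact hx' (Set.mem_iUnion.2 ⟨n, hn.le⟩)
    rw [eventually_false_iff_eq_bot, ae_eq_bot] at h2
    exact hμ0 h2
  obtain ⟨M, hM⟩ := hM
  have hmeas : MeasurableSet (K ∩ {x | g x ≤ M}) :=
    hK.measurableSet.inter (hgm measurableSet_Iic)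
  have hpos : 0 < μ (K ∩ {x | g x ≤ M}) := by
    rw [Set.inter_comm, measure_inter_conull hμK]
    exact pos_iff_ne_zero.2 hM
  obtain ⟨K', hK'sub, hK'cl, hK'pos⟩ := MeasurableSet.exists_lt_isClosed_of_ne_top hmeas (measure_ne_top _ _) hpos
  refine ⟨K', hK'sub.trans Set.inter_subset_left,
    hK.of_isClosed_subset hK'cl (hK'sub.trans Set.inter_subset_left), hK'pos.ne', ?_⟩
  set m := (μ Set.univ).toReal with hm
  -- `M` bounds the dyadic potential on `K'`, and the total mass `m` serves for `2 r > 1`. The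
  -- factor `4 ^ u` comes from recentring at a point of `K'`, which doubles `r`, and from rounding
  -- `2 r` up to a power of `1/2`.
  refine ⟨(M + m) * 4 ^ u, by positivity, fun x r hr => ?_⟩
  rw [Measure.restrict_apply Metric.isOpen_ball.measurableSet]
  rcases (Metric.ball x r ∩ K').eq_empty_or_nonempty with hemp | ⟨y, hyx, hyK⟩
  · simp [hemp]
  have hsub : Metric.ball x r ⊆ Metric.ball y (2 * r) := by
    refine Metric.ball_subset_ball' ?_
    rw [Metric.mem_ball, dist_comm] at hyx
    linarith
  refine (measure_mono (Set.inter_subset_left.trans hsub)).trans ?_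
  rcases le_or_gt (2 * r) 1 with hr1 | hr1
  · obtain ⟨k, hk1, hk2⟩ := exists_nat_pow_near_of_lt_one (show 0 < 2 * r by positivity) hr1
      (show (0 : ℝ) < 1 / 2 by norm_num) (by norm_num)
    have h1 : ENNReal.ofReal (((2 : ℝ) ^ u) ^ k) * μ (Metric.ball y ((2 : ℝ) ^ k)⁻¹) ≤ M :=
      (ENNReal.le_tsum k).trans (hK'sub hyK).2
    have h2 : μ (Metric.ball y (2 * r)) ≤ μ (Metric.ball y ((2 : ℝ) ^ k)⁻¹) := by
      refine measure_mono (Metric.ball_subset_ball ?_)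
      simpa using hk2
    have hpos' : (0 : ℝ) < (2 ^ u) ^ k := by positivity
    have h3 : μ (Metric.ball y ((2 : ℝ) ^ k)⁻¹) ≤ ENNReal.ofReal (M * (((2 : ℝ) ^ u) ^ k)⁻¹) := by
      rw [ENNReal.ofReal_mul (by positivity), ENNReal.ofReal_natCast,
        ENNReal.ofReal_inv_of_pos hpos', ← div_eq_mul_inv,
        ENNReal.le_div_iff_mul_le (Or.inl (by simpa using hpos')) (Or.inl ENNReal.ofReal_ne_top),
        mul_comm]
      exact h1
    refine (h2.trans h3).trans (ENNReal.ofReal_le_ofReal ?_)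
    have h4 : (((2 : ℝ) ^ u) ^ k)⁻¹ ≤ 4 ^ u * r ^ u := by
      have h5 : ((2 : ℝ) ^ k)⁻¹ ≤ 4 * r := by
        have : (1 / 2 : ℝ) ^ (k + 1) = ((2 : ℝ) ^ k)⁻¹ / 2 := by
          rw [pow_succ, one_div, inv_pow]; ring
        rw [this] at hk1
        linarith
      rw [← Real.mul_rpow (by norm_num) hr.le, ← Real.rpow_natCast, ← Real.rpow_mul two_pos.le,
        mul_comm u, Real.rpow_mul two_pos.le, Real.rpow_natCast, ← Real.inv_rpow (by positivity)]
      exact Real.rpow_le_rpow (by positivity) h5 hu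
    calc (M : ℝ) * (((2 : ℝ) ^ u) ^ k)⁻¹ ≤ M * (4 ^ u * r ^ u) := by gcongr
      _ ≤ (M + m) * (4 ^ u * r ^ u) := by gcongr; simp [hm]
      _ = _ := by ring
  · have h1 : μ (Metric.ball y (2 * r)) ≤ ENNReal.ofReal m := by
      rw [hm, ENNReal.ofReal_toReal (measure_ne_top _ _)]
      exact measure_mono (Set.subset_univ _)
    refine h1.trans (ENNReal.ofReal_le_ofReal ?_)
    have h2 : 1 ≤ (4 : ℝ) ^ u * r ^ u := by
      rw [← Real.mul_rpow (by norm_num) hr.le]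
      exact Real.one_le_rpow (by linarith) hu
    have h3 : (0 : ℝ) ≤ m := ENNReal.toReal_nonneg
    calc m ≤ M + m := by simp
      _ ≤ (M + m) * (4 ^ u * r ^ u) := le_mul_of_one_le_right (by positivity) h2
      _ = _ := by ring

variable {V : Type*} [NormedAddCommGroup V] [NormedSpace ℝ V]

/-- If `2 ^ k x` is within `ρ` of `n`, the ball of radius `2⁻ᵏ` about `x` lies in the cell of size
`ρ + 1`, on which the bump is at least `w ^ k`. Hence `∫ μ(B(x, 2⁻ᵏ)) dμ` is at most the sum of
squared cell masses, and its weight `2 ^ (a k)` is `w ^ (2 k)`, which is why the bumps carry the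
exponent `a / 2`. -/
theorem tsum_lintegral_ball_le_of_netBump [MeasurableSpace V] [BorelSpace V]
    {L : Set V} (hL : L.Countable) {ρ : ℝ} (hdense : ∀ x : V, ∃ n : L, ‖x - n‖ ≤ ρ)
    {a : ℝ} {μ : Measure V} [IsFiniteMeasure μ] {B : ℝ}
    (hint : ∀ p, Integrable (fun y => (netBump L ρ ((2 : ℝ) ^ (a / 2)) p y : ℝ)) μ)
    (hB : ∀ F : Finset (ℕ × L),
      ∑ p ∈ F, (∫ y, (netBump L ρ ((2 : ℝ) ^ (a / 2)) p y : ℝ) ∂μ) ^ 2 ≤ B) :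
    ∑' k : ℕ, ENNReal.ofReal (((2 : ℝ) ^ a) ^ k) * ∫⁻ x, μ (Metric.ball x ((2 : ℝ) ^ k)⁻¹) ∂μ
      ≤ ENNReal.ofReal B := by
  have : Countable L := hL
  set w : ℝ := (2 : ℝ) ^ (a / 2) with hw
  have hw0 : 0 < w := by positivity
  have hw2 : (2 : ℝ) ^ a = w ^ 2 := by
    rw [hw, ← Real.rpow_natCast, ← Real.rpow_mul two_pos.le]
    congr 1
    push_cast
    ring
  set m : ℕ × L → ℝ≥0∞ := fun p => μ {y | ‖(2 : ℝ) ^ p.1 • y - p.2‖ ≤ ρ + 1} with hm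
  have hmeas : ∀ (k : ℕ) (n : L) (c : ℝ), MeasurableSet {y : V | ‖(2 : ℝ) ^ k • y - n‖ ≤ c} :=
    fun k n c => (isClosed_le (by fun_prop) continuous_const).measurableSet
  have hball : ∀ k x, μ (Metric.ball x ((2 : ℝ) ^ k)⁻¹)
      ≤ ∑' n : L, Set.indicator {y : V | ‖(2 : ℝ) ^ k • y - n‖ ≤ ρ} (fun _ => m (k, n)) x := by
    intro k x
    obtain ⟨n, hn⟩ := hdense ((2 : ℝ) ^ k • x)
    refine le_trans ?_ (ENNReal.le_tsum n)
    rw [Set.indicator_of_mem (by exact hn)]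
    refine measure_mono fun y hy => ?_
    rw [Metric.mem_ball, dist_eq_norm] at hy
    have h0 : (0 : ℝ) < 2 ^ k := by positivity
    have h1 : ‖(2 : ℝ) ^ k • (y - x)‖ ≤ 1 := by
      rw [norm_smul, Real.norm_of_nonneg h0.le]
      calc (2 : ℝ) ^ k * ‖y - x‖ ≤ 2 ^ k * (2 ^ k)⁻¹ := by gcongr
        _ = 1 := mul_inv_cancel₀ h0.ne'
    change ‖(2 : ℝ) ^ k • y - n‖ ≤ ρ + 1
    calc ‖(2 : ℝ) ^ k • y - n‖ = ‖((2 : ℝ) ^ k • x - n) + (2 : ℝ) ^ k • (y - x)‖ := by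
          congr 1; rw [smul_sub]; abel
      _ ≤ _ := (norm_add_le _ _).trans (by linarith)
  have hk : ∀ k, ∫⁻ x, μ (Metric.ball x ((2 : ℝ) ^ k)⁻¹) ∂μ ≤ ∑' n : L, m (k, n) ^ 2 := by
    intro k
    refine (lintegral_mono (hball k)).trans ?_
    rw [lintegral_tsum fun n => (measurable_const.indicator (hmeas k n ρ)).aemeasurable]
    refine ENNReal.tsum_le_tsum fun n => ?_
    rw [lintegral_indicator_const (hmeas k n ρ), sq]
    gcongr
    exact measure_mono fun y (hy : _ ≤ ρ) => (by linarith : ‖(2 : ℝ) ^ k • y - n‖ ≤ ρ + 1)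
  have hmφ : ∀ p : ℕ × L, ENNReal.ofReal (w ^ p.1) * m p
      ≤ ENNReal.ofReal (∫ y, (netBump L ρ w p y : ℝ) ∂μ) := by
    intro p
    rw [ofReal_integral_eq_lintegral_ofReal (hint p)
      (Eventually.of_forall fun y => NNReal.coe_nonneg _),
      ← lintegral_indicator_const (hmeas p.1 p.2 (ρ + 1))]
    refine lintegral_mono fun y => ?_
    rw [Set.indicator_apply]
    split_ifs with hy
    · refine ENNReal.ofReal_le_ofReal ?_
      rw [netBump, Real.coe_toNNReal _ (by positivity)]
      refine le_mul_of_one_le_right (by positivity) (le_max_of_le_right ?_)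
      have hy' : ‖(2 : ℝ) ^ p.1 • y - p.2‖ ≤ ρ + 1 := hy
      linarith
    · exact zero_le
  calc ∑' k : ℕ, ENNReal.ofReal (((2 : ℝ) ^ a) ^ k) * ∫⁻ x, μ (Metric.ball x ((2 : ℝ) ^ k)⁻¹) ∂μ
      ≤ ∑' k : ℕ, ∑' n : L, (ENNReal.ofReal (w ^ k) * m (k, n)) ^ 2 := by
        refine ENNReal.tsum_le_tsum fun k => ?_
        simp_rw [mul_pow]
        rw [ENNReal.tsum_mul_left, ← ENNReal.ofReal_pow (by positivity), hw2, ← pow_mul, ← pow_mul,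
          mul_comm 2 k]
        gcongr
        exact hk k
    _ = ∑' p : ℕ × L, (ENNReal.ofReal (w ^ p.1) * m p) ^ 2 :=
        (ENNReal.tsum_prod' (f := fun p : ℕ × L => (ENNReal.ofReal (w ^ p.1) * m p) ^ 2)).symm
    _ ≤ ENNReal.ofReal B := by
        rw [ENNReal.tsum_eq_iSup_sum]
        refine iSup_le fun F => ?_
        refine le_trans ?_ (ENNReal.ofReal_le_ofReal (hB F))
        rw [ENNReal.ofReal_sum_of_nonneg fun p _ => sq_nonneg _]
        refine Finset.sum_le_sum fun p _ => ?_
        rw [ENNReal.ofReal_pow (integral_nonneg fun y => NNReal.coe_nonneg _)]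
        gcongr
        exact hmφ p

/-- Frostman's lemma for Borel sets. -/
theorem exists_isFrostman_of_lt_dimH [FiniteDimensional ℝ V] [MeasurableSpace V] [BorelSpace V]
    {E : Set V} (hE : MeasurableSet E) {a : ℝ} (ha : 0 ≤ a) (haE : ENNReal.ofReal a < dimH E) :
    ∃ K ⊆ E, IsCompact K ∧ ∃ μ : Measure V, IsFiniteMeasure μ ∧ μ ≠ 0 ∧ μ Kᶜ = 0 ∧
      IsFrostman μ a := by
  have : ProperSpace V := FiniteDimensional.proper ℝ V
  have : CompleteSpace V := FiniteDimensional.complete ℝ V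
  obtain ⟨L, ρ, M, hρ, hM, hL, hdense, hS⟩ := exists_countable_net V
  obtain ⟨b, hab, hbE⟩ := ENNReal.lt_iff_exists_nnreal_btwn.1 haE
  have hab' : a < b := by
    rwa [← ENNReal.ofReal_coe_nnreal, ENNReal.ofReal_lt_ofReal_iff_of_nonneg ha] at hab
  have hne : Measure.hausdorffMeasure (b : ℝ) E ≠ 0 := by
    rw [hausdorffMeasure_of_lt_dimH hbE]
    exact ENNReal.top_ne_zero
  set φ := netBump L ρ ((2 : ℝ) ^ (a / 2)) with hφ
  have hφc : ∀ p, Continuous (φ p) := continuous_netBump L ρ _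
  -- Positive capacity: otherwise the Hausdorff measure of exponent `b > a` would vanish on `E`.
  obtain ⟨ε, hε, hεE⟩ : ∃ ε : ℝ, 0 < ε ∧ ∀ f ∈ admissible φ E, ε ≤ ‖f‖ := by
    by_contra! hcon
    refine hne (hausdorffMeasure_eq_zero_of_admissible hρ hM hL hS ha hab' fun ε hε => ?_)
    obtain ⟨f, hf, hfε⟩ := hcon ε hε
    exact ⟨f, hf, hfε.le⟩
  obtain ⟨K, hKE, hK, hKc⟩ := AnalyticSet.exists_isCompact_le_norm_admissible hφc
    hE.analyticSet (half_lt_self hε) (half_pos hε) hεE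
  have hKne : K.Nonempty := by
    rw [Set.nonempty_iff_ne_empty]
    rintro rfl
    have := hKc 0 ⟨fun i => le_rfl, fun x hx => hx.elim⟩
    rw [norm_zero] at this
    linarith
  have : CompactSpace K := isCompact_iff_compactSpace.1 hK
  have : Nonempty K := hKne.to_subtype
  obtain ⟨μ, hμ⟩ := exists_probabilityMeasure_sum_sq_le (Y := K) (φ := fun p x => φ p x)
    (fun p => (hφc p).comp continuous_subtype_val) (half_pos hε)
    (fun f hf => hKc f ⟨hf.1, fun x hx => hf.2 ⟨x, hx⟩ trivial⟩)
  have hemb : MeasurableEmbedding ((↑) : K → V) := MeasurableEmbedding.subtype_coe hK.measurableSet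
  set ν : Measure V := (μ : Measure K).map (↑) with hν
  have hνprob : IsProbabilityMeasure ν :=
    Measure.isProbabilityMeasure_map measurable_subtype_coe.aemeasurable
  have hνK : ν Kᶜ = 0 := by
    rw [hν, hemb.map_apply]
    simp
  have hint : ∀ p, Integrable (fun y => (φ p y : ℝ)) ν := fun p => by
    rw [hν, hemb.integrable_map_iff]
    exact (NNReal.continuous_coe.comp
      ((hφc p).comp continuous_subtype_val)).integrable_of_hasCompactSupport
        (HasCompactSupport.of_compactSpace _)
  have hle := tsum_lintegral_ball_le_of_netBump hL hdense (μ := ν) hint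
    (B := 1 / (ε / 2) ^ 2) (fun F => by
      refine le_trans (le_of_eq ?_) (hμ F)
      refine Finset.sum_congr rfl fun p _ => ?_
      rw [hν, hemb.integral_map])
  obtain ⟨K', hK'K, hK'c, hK'pos, hK'F⟩ := exists_isFrostman_restrict
    (IsProbabilityMeasure.ne_zero ν) ha hK hνK (hle.trans_lt ENNReal.ofReal_lt_top).ne
  refine ⟨K', hK'K.trans hKE, hK'c, ν.restrict K', inferInstance, ?_, ?_, hK'F⟩
  · rwa [Ne, Measure.restrict_eq_zero]
  · rw [Measure.restrict_apply hK'c.measurableSet.compl, Set.compl_inter_self, measure_empty]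

/-- A nonempty Borel set carries Frostman measures of exponent arbitrarily close to its Hausdorff
dimension. -/
theorem exists_isFrostman_add_lt [FiniteDimensional ℝ V] [MeasurableSpace V] [BorelSpace V]
    {E : Set V} (hE : MeasurableSet E) (hne : E.Nonempty) {ε : ℝ} (hε : 0 < ε) :
    ∃ a : ℝ, (dimH E).toReal < a + ε ∧
      ∃ K ⊆ E, IsCompact K ∧ ∃ μ : Measure V, IsFiniteMeasure μ ∧ μ ≠ 0 ∧ μ Kᶜ = 0 ∧
        IsFrostman μ a := by
  rcases lt_or_ge 0 (dimH E) with hpos | hzero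
  · have hfin : dimH E ≠ ∞ := Real.dimH_ne_top E
    have hpos' : 0 < (dimH E).toReal := ENNReal.toReal_pos hpos.ne' hfin
    set a := max 0 ((dimH E).toReal - ε / 2) with ha
    have ha0 : 0 ≤ a := le_max_left _ _
    have halt : ENNReal.ofReal a < dimH E := by
      rw [ENNReal.ofReal_lt_iff_lt_toReal ha0 hfin]
      exact max_lt hpos' (by linarith)
    refine ⟨a, ?_, exists_isFrostman_of_lt_dimH hE ha0 halt⟩
    have := le_max_right 0 ((dimH E).toReal - ε / 2)
    linarith
  -- In dimension zero there is no non-negative exponent below the dimension; a Dirac mass has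
  -- exponent `0`.
  · obtain ⟨x, hx⟩ := hne
    have h0 : dimH E = 0 := le_antisymm hzero zero_le
    refine ⟨0, by simpa [h0] using hε, {x}, by simpa using hx,
      isCompact_singleton, Measure.dirac x, inferInstance, IsProbabilityMeasure.ne_zero _, by simp,
      1, zero_le_one, fun y r _ => ?_⟩
    rw [Real.rpow_zero, mul_one, ENNReal.ofReal_one]
    exact prob_le_one

end Frostman

/-! ### Fourier transforms of measures and Gaussian energies -/

section FourierGaussian

open Filter Topology

/-- The additive character `t ↦ exp (-2πit)`. -/
noncomputable def fourierExp (t : ℝ) : ℂ := Complex.exp (-2 * (Real.pi : ℂ) * Complex.I * (t : ℂ))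

theorem norm_fourierExp (t : ℝ) : ‖fourierExp t‖ = 1 := by
  rw [fourierExp, show -2 * (Real.pi : ℂ) * Complex.I * (t : ℂ)
    = ((-2 * Real.pi * t : ℝ) : ℂ) * Complex.I by push_cast; ring, Complex.norm_exp_ofReal_mul_I]

theorem continuous_fourierExp : Continuous fourierExp := by
  unfold fourierExp
  fun_prop

theorem fourierExp_add (s t : ℝ) : fourierExp (s + t) = fourierExp s * fourierExp t := by
  rw [fourierExp, fourierExp, fourierExp, ← Complex.exp_add]
  congr 1
  push_cast
  ring

theorem conj_fourierExp (t : ℝ) : (starRingEnd ℂ) (fourierExp t) = fourierExp (-t) := by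
  rw [fourierExp, fourierExp, ← Complex.exp_conj]
  congr 1
  simp [map_mul, map_neg, Complex.conj_ofNat]

variable {V : Type*} [NormedAddCommGroup V] [InnerProductSpace ℝ V] [FiniteDimensional ℝ V]
  [MeasurableSpace V] [BorelSpace V]

/-- The Fourier transform of a measure on an inner product space. -/
noncomputable def mhat (μ : Measure V) (ξ : V) : ℂ := ∫ x, fourierExp (inner ℝ ξ x) ∂μ

omit [FiniteDimensional ℝ V] in
theorem integrable_fourierExp_inner (μ : Measure V) [IsFiniteMeasure μ] [SecondCountableTopology V]
    (ξ : V) : Integrable (fun x => fourierExp (inner ℝ ξ x)) μ :=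
  Integrable.of_bound (continuous_fourierExp.comp (by fun_prop)).aestronglyMeasurable 1
    (Eventually.of_forall fun x => (norm_fourierExp _).le)

omit [FiniteDimensional ℝ V] [BorelSpace V] in
theorem norm_mhat_le (μ : Measure V) (ξ : V) : ‖mhat μ ξ‖ ≤ μ.real Set.univ := by
  rw [mhat]
  refine (norm_integral_le_integral_norm _).trans ?_
  simp [norm_fourierExp]

theorem continuous_mhat (μ : Measure V) [IsFiniteMeasure μ] : Continuous (mhat μ) := by
  refine continuous_of_dominated (bound := fun _ => 1)
    (fun ξ => (integrable_fourierExp_inner μ ξ).aestronglyMeasurable)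
    (fun ξ => Eventually.of_forall fun x => (norm_fourierExp _).le) (integrable_const _)
    (Eventually.of_forall fun x => continuous_fourierExp.comp (by fun_prop))

omit [BorelSpace V] in
theorem norm_sq_mhat (μ : Measure V) [IsFiniteMeasure μ] (ξ : V) :
    ((‖mhat μ ξ‖ ^ 2 : ℝ) : ℂ) = ∫ p, fourierExp (inner ℝ ξ (p.1 - p.2)) ∂(μ.prod μ) := by
  have h : (starRingEnd ℂ) (mhat μ ξ) = ∫ x, fourierExp (-inner ℝ ξ x) ∂μ := by
    rw [mhat, ← integral_conj]
    simp_rw [conj_fourierExp]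
  rw [← Complex.normSq_eq_norm_sq, ← Complex.mul_conj, h, mhat, ← integral_prod_mul]
  refine integral_congr_ae (Eventually.of_forall fun p => ?_)
  simp only
  rw [← fourierExp_add, inner_sub_right, sub_eq_add_neg]

/-- The Fourier transform of a Gaussian. -/
theorem integral_gaussian_mul_fourierExp {R : ℝ} (hR : 0 < R) (w : V) :
    ∫ ξ : V, ((Real.exp (-Real.pi * ‖ξ‖ ^ 2 / R ^ 2) : ℝ) : ℂ) * fourierExp (inner ℝ ξ w)
      = ((R ^ Module.finrank ℝ V * Real.exp (-Real.pi * R ^ 2 * ‖w‖ ^ 2) : ℝ) : ℂ) := by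
  have hb : 0 < (((Real.pi / R ^ 2 : ℝ) : ℂ)).re := by
    rw [Complex.ofReal_re]; positivity
  have h := GaussianFourier.integral_cexp_neg_mul_sq_norm_add hb
    (-2 * (Real.pi : ℂ) * Complex.I) w
  have h1 : ∀ ξ : V, ((Real.exp (-Real.pi * ‖ξ‖ ^ 2 / R ^ 2) : ℝ) : ℂ) * fourierExp (inner ℝ ξ w)
      = Complex.exp (-((Real.pi / R ^ 2 : ℝ) : ℂ) * ‖ξ‖ ^ 2
        + -2 * (Real.pi : ℂ) * Complex.I * (inner ℝ w ξ : ℝ)) := fun ξ => by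
    rw [fourierExp, Complex.ofReal_exp, ← Complex.exp_add, real_inner_comm]
    congr 1
    push_cast
    ring
  simp_rw [h1]
  refine h.trans ?_
  have hπ : (Real.pi : ℂ) ≠ 0 := by exact_mod_cast Real.pi_pos.ne'
  have hRc : (R : ℂ) ≠ 0 := by exact_mod_cast hR.ne'
  have h2 : (Real.pi : ℂ) / ((Real.pi / R ^ 2 : ℝ) : ℂ) = ((R ^ 2 : ℝ) : ℂ) := by
    push_cast
    field_simp
  have h3 : ((Module.finrank ℝ V : ℂ) / 2) = (((Module.finrank ℝ V : ℝ) / 2 : ℝ) : ℂ) := by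
    push_cast; rfl
  rw [h2, h3, ← Complex.ofReal_cpow (by positivity), Complex.ofReal_mul, Complex.ofReal_exp]
  congr 2
  · rw [← Real.rpow_natCast, ← Real.rpow_natCast, ← Real.rpow_mul hR.le]
    congr 1
    push_cast
    ring
  · push_cast
    field_simp
    ring_nf
    rw [Complex.I_sq]
    ring

theorem integrable_gaussian {R : ℝ} (hR : 0 < R) :
    Integrable fun ξ : V => Real.exp (-Real.pi * ‖ξ‖ ^ 2 / R ^ 2) := by
  have hb : 0 < (((Real.pi / R ^ 2 : ℝ) : ℂ)).re := by
    rw [Complex.ofReal_re]; positivity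
  have h := (GaussianFourier.integrable_cexp_neg_mul_sq_norm_add (V := V) hb 0 0).norm
  refine h.congr (Eventually.of_forall fun ξ => ?_)
  simp only
  rw [Complex.norm_exp]
  congr 1
  simp only [zero_mul, add_zero]
  rw [show -((Real.pi / R ^ 2 : ℝ) : ℂ) * (‖ξ‖ : ℂ) ^ 2 = ((-Real.pi * ‖ξ‖ ^ 2 / R ^ 2 : ℝ) : ℂ) by
    push_cast; ring, Complex.ofReal_re]

/-- The energy of a measure with respect to the Gaussian kernel of width `1 / R`. -/
noncomputable def gaussianEnergy (μ : Measure V) (R : ℝ) : ℝ≥0∞ :=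
  ∫⁻ x, ∫⁻ y, ENNReal.ofReal (Real.exp (-Real.pi * R ^ 2 * ‖x - y‖ ^ 2)) ∂μ ∂μ

/-- Parseval with a Gaussian cutoff: `|μ̂|²` is the transform of the difference distribution of `μ ×
μ`, and the cutoff makes Fubini absolutely convergent. -/
theorem lintegral_norm_sq_mhat_mul_gaussian (μ : Measure V) [IsFiniteMeasure μ] {R : ℝ}
    (hR : 0 < R) :
    ∫⁻ ξ : V, ENNReal.ofReal (‖mhat μ ξ‖ ^ 2 * Real.exp (-Real.pi * ‖ξ‖ ^ 2 / R ^ 2))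
      = ENNReal.ofReal (R ^ Module.finrank ℝ V) * gaussianEnergy μ R := by
  have hg := integrable_gaussian (V := V) hR
  have hL : Integrable fun ξ : V => ‖mhat μ ξ‖ ^ 2 * Real.exp (-Real.pi * ‖ξ‖ ^ 2 / R ^ 2) :=
    hg.bdd_mul ((continuous_mhat μ).norm.pow 2).aestronglyMeasurable
      (c := μ.real Set.univ ^ 2) (Eventually.of_forall fun ξ => by
        rw [norm_pow, norm_norm]
        exact pow_le_pow_left₀ (norm_nonneg _) (norm_mhat_le μ ξ) 2)
  have hK : Integrable (fun p : V × V => Real.exp (-Real.pi * R ^ 2 * ‖p.1 - p.2‖ ^ 2))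
      (μ.prod μ) := by
    refine Integrable.of_bound (Continuous.aestronglyMeasurable (by fun_prop)) 1
      (Eventually.of_forall fun p => ?_)
    rw [Real.norm_of_nonneg (Real.exp_pos _).le, Real.exp_le_one_iff]
    have := Real.pi_pos
    have : 0 ≤ Real.pi * R ^ 2 * ‖p.1 - p.2‖ ^ 2 := by positivity
    linarith
  have hmain : ∫ ξ : V, ‖mhat μ ξ‖ ^ 2 * Real.exp (-Real.pi * ‖ξ‖ ^ 2 / R ^ 2)
      = ∫ p : V × V, R ^ Module.finrank ℝ V
        * Real.exp (-Real.pi * R ^ 2 * ‖p.1 - p.2‖ ^ 2) ∂(μ.prod μ) := by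
    rw [← Complex.ofReal_inj, ← integral_complex_ofReal, ← integral_complex_ofReal]
    simp_rw [Complex.ofReal_mul _ (Real.exp _), norm_sq_mhat, mul_comm _ (((Real.exp _ : ℝ)) : ℂ)]
    calc ∫ ξ : V, ((Real.exp (-Real.pi * ‖ξ‖ ^ 2 / R ^ 2) : ℝ) : ℂ) *
          ∫ p, fourierExp (inner ℝ ξ (p.1 - p.2)) ∂(μ.prod μ)
        = ∫ ξ : V, ∫ p, ((Real.exp (-Real.pi * ‖ξ‖ ^ 2 / R ^ 2) : ℝ) : ℂ) *
          fourierExp (inner ℝ ξ (p.1 - p.2)) ∂(μ.prod μ) := by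
          simp_rw [integral_const_mul]
      _ = ∫ p, (∫ ξ : V, ((Real.exp (-Real.pi * ‖ξ‖ ^ 2 / R ^ 2) : ℝ) : ℂ) *
          fourierExp (inner ℝ ξ (p.1 - p.2))) ∂(μ.prod μ) := by
          refine integral_integral_swap ?_
          refine ((hg.comp_fst (μ.prod μ)).mono ?_ (Eventually.of_forall fun z => ?_))
          · refine Continuous.aestronglyMeasurable ?_
            exact (by fun_prop : Continuous fun z : V × V × V =>
              ((Real.exp (-Real.pi * ‖z.1‖ ^ 2 / R ^ 2) : ℝ) : ℂ)).mul
                (continuous_fourierExp.comp (by fun_prop))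
          · simp only [Function.uncurry]
            rw [norm_mul, norm_fourierExp, mul_one, Complex.norm_real]
      _ = _ := by
          refine integral_congr_ae (Eventually.of_forall fun p => ?_)
          simp only
          rw [integral_gaussian_mul_fourierExp hR]
          push_cast
          ring
  rw [← ofReal_integral_eq_lintegral_ofReal hL (Eventually.of_forall fun ξ => by positivity), hmain,
    integral_const_mul, ENNReal.ofReal_mul (by positivity),
    ofReal_integral_eq_lintegral_ofReal hK (Eventually.of_forall fun p => by positivity),
    gaussianEnergy, lintegral_prod _ (Measurable.aemeasurable (by fun_prop))]

end FourierGaussian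

/-! ### Frostman exponents, Sobolev integrals and dyadic energies -/

section Energy

open Filter Topology

variable {V : Type*} [NormedAddCommGroup V] [InnerProductSpace ℝ V] [FiniteDimensional ℝ V]
  [MeasurableSpace V] [BorelSpace V]

theorem summable_exp_neg_mul_succ_rpow (u : ℝ) :
    Summable fun j : ℕ => Real.exp (-j) * ((j : ℝ) + 1) ^ u := by
  obtain ⟨N, hN⟩ := exists_nat_ge u
  have h1 : Summable fun n : ℕ => ((n : ℝ)) ^ N * Real.exp (-1 * n) :=
    Real.summable_pow_mul_exp_neg_nat_mul N one_pos
  have h2 := ((summable_nat_add_iff 1).2 h1).mul_left (Real.exp 1)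
  refine Summable.of_nonneg_of_le (fun j => by positivity) (fun j => ?_) h2
  have h3 : ((j : ℝ) + 1) ^ u ≤ ((j : ℝ) + 1) ^ N := by
    rw [← Real.rpow_natCast]
    exact Real.rpow_le_rpow_of_exponent_le (by linarith [Nat.cast_nonneg (α := ℝ) j]) hN
  have h4 : Real.exp (-j) = Real.exp 1 * Real.exp (-1 * ((j + 1 : ℕ) : ℝ)) := by
    rw [← Real.exp_add]
    congr 1
    push_cast
    ring
  rw [h4]
  push_cast
  calc Real.exp 1 * Real.exp (-1 * ((j : ℝ) + 1)) * ((j : ℝ) + 1) ^ u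
      ≤ Real.exp 1 * Real.exp (-1 * ((j : ℝ) + 1)) * ((j : ℝ) + 1) ^ N := by gcongr
    _ = _ := by ring

-- Split by `j = ⌊R ‖x - y‖⌋`: the Gaussian is at most `e⁻ʲ` there, and the ball of radius `(j + 1)
-- / R` has mass `O(((j + 1) / R) ^ u)`.
omit [InnerProductSpace ℝ V] [FiniteDimensional ℝ V] in
theorem IsFrostman.lintegral_gaussian_le {μ : Measure V} {u : ℝ} (hμ : IsFrostman μ u) :
    ∃ C : ℝ, 0 ≤ C ∧ ∀ (R : ℝ) (x : V), 0 < R →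
      ∫⁻ y, ENNReal.ofReal (Real.exp (-Real.pi * R ^ 2 * ‖x - y‖ ^ 2)) ∂μ
        ≤ ENNReal.ofReal (C * R ^ (-u)) := by
  obtain ⟨C, hC0, hC⟩ := hμ
  have hsum := summable_exp_neg_mul_succ_rpow u
  refine ⟨C * ∑' j : ℕ, Real.exp (-j) * ((j : ℝ) + 1) ^ u,
    mul_nonneg hC0 (tsum_nonneg fun j => by positivity), fun R x hR => ?_⟩
  have hpt : ∀ y : V, ENNReal.ofReal (Real.exp (-Real.pi * R ^ 2 * ‖x - y‖ ^ 2))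
      ≤ ∑' j : ℕ, (Metric.ball x (((j : ℝ) + 1) / R)).indicator
        (fun _ => ENNReal.ofReal (Real.exp (-(j : ℝ)))) y := by
    intro y
    set s := R * ‖x - y‖ with hs
    have hs0 : 0 ≤ s := by positivity
    refine le_trans ?_ (ENNReal.le_tsum ⌊s⌋₊)
    rw [Set.indicator_of_mem]
    · refine ENNReal.ofReal_le_ofReal (Real.exp_le_exp.2 ?_)
      have h1 : ((⌊s⌋₊ : ℕ) : ℝ) ≤ s := Nat.floor_le hs0
      have h2 : ((⌊s⌋₊ : ℕ) : ℝ) ≤ ((⌊s⌋₊ : ℕ) : ℝ) ^ 2 := by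
        exact_mod_cast Nat.le_self_pow two_ne_zero _
      have h3 : ((⌊s⌋₊ : ℕ) : ℝ) ^ 2 ≤ s ^ 2 := by gcongr
      have h4 : R ^ 2 * ‖x - y‖ ^ 2 = s ^ 2 := by rw [hs]; ring
      have h5 := Real.pi_gt_three
      rw [mul_assoc, h4]
      nlinarith [sq_nonneg s]
    · rw [Metric.mem_ball, dist_comm, dist_eq_norm, lt_div_iff₀ hR, mul_comm]
      exact Nat.lt_floor_add_one s
  refine (lintegral_mono hpt).trans ?_
  rw [lintegral_tsum fun j => (measurable_const.indicator
    Metric.isOpen_ball.measurableSet).aemeasurable]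
  simp_rw [lintegral_indicator_const Metric.isOpen_ball.measurableSet]
  calc ∑' j : ℕ, ENNReal.ofReal (Real.exp (-(j : ℝ))) * μ (Metric.ball x (((j : ℝ) + 1) / R))
      ≤ ∑' j : ℕ, ENNReal.ofReal (C * R ^ (-u) * (Real.exp (-(j : ℝ)) * ((j : ℝ) + 1) ^ u)) := by
        refine ENNReal.tsum_le_tsum fun j => ?_
        refine (mul_le_mul_right (hC x _ (by positivity)) _).trans (le_of_eq ?_)
        rw [← ENNReal.ofReal_mul (Real.exp_pos _).le, Real.div_rpow (by positivity) hR.le,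
          Real.rpow_neg hR.le]
        congr 1
        ring
    _ = ENNReal.ofReal (C * (∑' j : ℕ, Real.exp (-j) * ((j : ℝ) + 1) ^ u) * R ^ (-u)) := by
        rw [← ENNReal.ofReal_tsum_of_nonneg (fun j => by positivity) (hsum.mul_left _),
          tsum_mul_left]
        congr 1
        ring

omit [InnerProductSpace ℝ V] [FiniteDimensional ℝ V] in
theorem IsFrostman.gaussianEnergy_le {μ : Measure V} [IsFiniteMeasure μ] {u : ℝ}
    (hμ : IsFrostman μ u) :
    ∃ C : ℝ, 0 ≤ C ∧ ∀ R : ℝ, 0 < R → gaussianEnergy μ R ≤ ENNReal.ofReal (C * R ^ (-u)) := by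
  obtain ⟨C, hC0, hC⟩ := hμ.lintegral_gaussian_le
  refine ⟨C * μ.real Set.univ, by positivity, fun R hR => ?_⟩
  refine (lintegral_mono fun x => hC R x hR).trans ?_
  rw [lintegral_const, ← ENNReal.ofReal_toReal (measure_ne_top μ Set.univ),
    ← ENNReal.ofReal_mul (by positivity)]
  refine ENNReal.ofReal_le_ofReal (le_of_eq ?_)
  rw [Measure.real]
  ring

/-- The `L²` average growth of the Fourier transform of a Frostman measure. -/
theorem IsFrostman.lintegral_norm_sq_mhat_mul_gaussian_le {μ : Measure V} [IsFiniteMeasure μ]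
    {u : ℝ} (hμ : IsFrostman μ u) :
    ∃ C : ℝ, 0 ≤ C ∧ ∀ R : ℝ, 0 < R →
      ∫⁻ ξ : V, ENNReal.ofReal (‖mhat μ ξ‖ ^ 2 * Real.exp (-Real.pi * ‖ξ‖ ^ 2 / R ^ 2))
        ≤ ENNReal.ofReal (C * R ^ ((Module.finrank ℝ V : ℝ) - u)) := by
  obtain ⟨C, hC0, hC⟩ := hμ.gaussianEnergy_le
  refine ⟨C, hC0, fun R hR => ?_⟩
  rw [lintegral_norm_sq_mhat_mul_gaussian μ hR]
  refine (mul_le_mul_right (hC R hR) _).trans (le_of_eq ?_)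
  rw [← ENNReal.ofReal_mul (by positivity), Real.rpow_sub hR, Real.rpow_neg hR.le,
    Real.rpow_natCast]
  congr 1
  ring

/-- A Frostman measure of exponent `u` has Sobolev dimension at least `u`. -/
theorem IsFrostman.lintegral_norm_sq_mhat_lt_top {μ : Measure V} [IsFiniteMeasure μ]
    {u v : ℝ} (hμ : IsFrostman μ u) (hvu : v < u) :
    ∫⁻ ξ : V, ENNReal.ofReal (‖mhat μ ξ‖ ^ 2 * (1 + ‖ξ‖) ^ (v - (Module.finrank ℝ V : ℝ))) < ∞ := by
  obtain ⟨C, hC0, hC⟩ := hμ.lintegral_norm_sq_mhat_mul_gaussian_le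
  set e : ℝ := v - (Module.finrank ℝ V : ℝ) with he
  -- For `2 ^ k ≤ 1 + ‖ξ‖ < 2 ^ (k + 1)`, the first factor replaces `1 + ‖ξ‖` by `2 ^ k` and the
  -- second undoes the Gaussian at radius `2 ^ k`. The dyadic sum is then geometric of ratio `2 ^ (v
  -- - u)`.
  set A : ℝ := 2 ^ |e| * Real.exp (4 * Real.pi) with hA
  have hA0 : 0 ≤ A := by positivity
  have hpt : ∀ ξ : V, ENNReal.ofReal (‖mhat μ ξ‖ ^ 2 * (1 + ‖ξ‖) ^ e)
      ≤ ∑' k : ℕ, ENNReal.ofReal (A * ((2 : ℝ) ^ k) ^ e) * ENNReal.ofReal (‖mhat μ ξ‖ ^ 2 *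
        Real.exp (-Real.pi * ‖ξ‖ ^ 2 / ((2 : ℝ) ^ k) ^ 2)) := by
    intro ξ
    obtain ⟨k, hk1, hk2⟩ := exists_nat_pow_near (show 1 ≤ 1 + ‖ξ‖ by linarith [norm_nonneg ξ])
      one_lt_two
    refine le_trans ?_ (ENNReal.le_tsum k)
    have h2k : (0 : ℝ) < 2 ^ k := by positivity
    rw [← ENNReal.ofReal_mul (by positivity)]
    refine ENNReal.ofReal_le_ofReal ?_
    have h1 : (1 + ‖ξ‖) ^ e ≤ 2 ^ |e| * ((2 : ℝ) ^ k) ^ e := by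
      set t := (1 + ‖ξ‖) / 2 ^ k with ht
      have ht1 : 1 ≤ t := by rw [ht, one_le_div h2k]; exact hk1
      have ht2 : t ≤ 2 := by
        rw [ht, div_le_iff₀ h2k]
        rw [pow_succ] at hk2
        linarith
      have h3 : 1 + ‖ξ‖ = t * 2 ^ k := by rw [ht]; field_simp
      rw [h3, Real.mul_rpow (by linarith) h2k.le]
      gcongr
      calc t ^ e ≤ t ^ |e| := Real.rpow_le_rpow_of_exponent_le ht1 (le_abs_self e)
        _ ≤ 2 ^ |e| := Real.rpow_le_rpow (by linarith) ht2 (abs_nonneg e)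
    have h2 : 1 ≤ Real.exp (4 * Real.pi) * Real.exp (-Real.pi * ‖ξ‖ ^ 2 / ((2 : ℝ) ^ k) ^ 2) := by
      rw [← Real.exp_add]
      refine Real.one_le_exp ?_
      have h3 : ‖ξ‖ ≤ 2 * 2 ^ k := by rw [pow_succ] at hk2; linarith
      have h4 : ‖ξ‖ ^ 2 / ((2 : ℝ) ^ k) ^ 2 ≤ 4 := by
        rw [div_le_iff₀ (by positivity)]
        nlinarith [norm_nonneg ξ]
      have h5 := Real.pi_pos
      rw [mul_div_assoc]
      nlinarith
    calc ‖mhat μ ξ‖ ^ 2 * (1 + ‖ξ‖) ^ e ≤ ‖mhat μ ξ‖ ^ 2 * (2 ^ |e| * ((2 : ℝ) ^ k) ^ e) := by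
          gcongr
      _ ≤ ‖mhat μ ξ‖ ^ 2 * (2 ^ |e| * ((2 : ℝ) ^ k) ^ e) *
          (Real.exp (4 * Real.pi) * Real.exp (-Real.pi * ‖ξ‖ ^ 2 / ((2 : ℝ) ^ k) ^ 2)) :=
        le_mul_of_one_le_right (by positivity) h2
      _ = _ := by rw [hA]; ring
  refine (lintegral_mono hpt).trans_lt ?_
  have hmeas : ∀ R : ℝ, Measurable fun ξ : V => ENNReal.ofReal (‖mhat μ ξ‖ ^ 2 *
      Real.exp (-Real.pi * ‖ξ‖ ^ 2 / R ^ 2)) := fun R => by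
    have := (continuous_mhat μ).measurable
    fun_prop
  rw [lintegral_tsum fun k => ((hmeas _).const_mul _).aemeasurable]
  simp_rw [lintegral_const_mul _ (hmeas _)]
  have hq : (2 : ℝ) ^ (v - u) < 1 := Real.rpow_lt_one_of_one_lt_of_neg one_lt_two (by linarith)
  calc ∑' k : ℕ, ENNReal.ofReal (A * ((2 : ℝ) ^ k) ^ e) * ∫⁻ ξ : V, ENNReal.ofReal
        (‖mhat μ ξ‖ ^ 2 * Real.exp (-Real.pi * ‖ξ‖ ^ 2 / ((2 : ℝ) ^ k) ^ 2))
      ≤ ∑' k : ℕ, ENNReal.ofReal (A * C * ((2 : ℝ) ^ (v - u)) ^ k) := by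
        refine ENNReal.tsum_le_tsum fun k => ?_
        refine (mul_le_mul_right (hC _ (by positivity)) _).trans (le_of_eq ?_)
        rw [← ENNReal.ofReal_mul (by positivity), ← Real.rpow_natCast, ← Real.rpow_natCast,
          ← Real.rpow_mul two_pos.le, ← Real.rpow_mul two_pos.le, ← Real.rpow_mul two_pos.le]
        congr 1
        have h6 : (2 : ℝ) ^ ((v - u) * (k : ℝ)) = 2 ^ ((k : ℝ) * e) *
            2 ^ ((k : ℝ) * ((Module.finrank ℝ V : ℝ) - u)) := by
          rw [← Real.rpow_add two_pos, he]
          congr 1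
          ring
        rw [h6]
        ring
    _ < ∞ := by
        rw [← ENNReal.ofReal_tsum_of_nonneg (fun k => by positivity)
          ((summable_geometric_of_lt_one (by positivity) hq).mul_left _)]
        exact ENNReal.ofReal_lt_top

/-- A measure of Sobolev dimension larger than `u` has finite dyadic `u`-energy. -/
theorem tsum_lintegral_ball_ne_top {μ : Measure V} [IsFiniteMeasure μ] {u s : ℝ} (hus : u < s)
    (hs : s ≤ Module.finrank ℝ V)
    (h : ∫⁻ ξ : V, ENNReal.ofReal (‖mhat μ ξ‖ ^ 2 *
      (1 + ‖ξ‖) ^ (s - (Module.finrank ℝ V : ℝ))) < ∞) :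
    ∑' k : ℕ, ENNReal.ofReal (((2 : ℝ) ^ u) ^ k) *
      ∫⁻ x, μ (Metric.ball x ((2 : ℝ) ^ k)⁻¹) ∂μ ≠ ∞ := by
  set D := Module.finrank ℝ V with hD
  set I := ∫⁻ ξ : V, ENNReal.ofReal (‖mhat μ ξ‖ ^ 2 * (1 + ‖ξ‖) ^ (s - (D : ℝ))) with hI
  -- Bounds `exp (-π t²) (1 + t) ^ (D - s)` for `t = ‖ξ‖ / 2 ^ k`, through `1 + t ≤ exp t`; this is
  -- where `s ≤ D` enters.
  set A : ℝ := Real.exp (((D : ℝ) - s) ^ 2) with hA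
  have hA0 : 0 < A := Real.exp_pos _
  have hball : ∀ k : ℕ, ∫⁻ x, μ (Metric.ball x ((2 : ℝ) ^ k)⁻¹) ∂μ
      ≤ ENNReal.ofReal (Real.exp Real.pi) * gaussianEnergy μ ((2 : ℝ) ^ k) := by
    intro k
    have hm : Measurable fun x => ∫⁻ y, ENNReal.ofReal
        (Real.exp (-Real.pi * ((2 : ℝ) ^ k) ^ 2 * ‖x - y‖ ^ 2)) ∂μ :=
      Measurable.lintegral_prod_right' (f := fun p : V × V => ENNReal.ofReal
        (Real.exp (-Real.pi * ((2 : ℝ) ^ k) ^ 2 * ‖p.1 - p.2‖ ^ 2))) (by fun_prop)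
    rw [gaussianEnergy, ← lintegral_const_mul _ hm]
    refine lintegral_mono fun x => ?_
    rw [← lintegral_const_mul _ (by fun_prop), ← lintegral_indicator_one
      Metric.isOpen_ball.measurableSet]
    refine lintegral_mono fun y => ?_
    by_cases hy : y ∈ Metric.ball x ((2 : ℝ) ^ k)⁻¹
    · rw [Set.indicator_of_mem hy, ← ENNReal.ofReal_mul (Real.exp_pos _).le, ← Real.exp_add, Pi.one_apply,
        ENNReal.one_le_ofReal]
      refine Real.one_le_exp ?_
      rw [Metric.mem_ball, dist_comm, dist_eq_norm] at hy
      have h2k : (0 : ℝ) < 2 ^ k := by positivity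
      have h1 : 2 ^ k * ‖x - y‖ ≤ 1 := by
        calc (2 : ℝ) ^ k * ‖x - y‖ ≤ 2 ^ k * (2 ^ k)⁻¹ := by gcongr
          _ = 1 := mul_inv_cancel₀ h2k.ne'
      have h2 : (2 ^ k * ‖x - y‖) ^ 2 ≤ 1 := pow_le_one₀ (by positivity) h1
      have h3 := Real.pi_pos
      have h4 : -Real.pi * ((2 : ℝ) ^ k) ^ 2 * ‖x - y‖ ^ 2
        = -Real.pi * (2 ^ k * ‖x - y‖) ^ 2 := by ring
      rw [h4]
      nlinarith
    · rw [Set.indicator_of_notMem hy]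
      exact zero_le
  have henergy : ∀ k : ℕ, gaussianEnergy μ ((2 : ℝ) ^ k)
      ≤ ENNReal.ofReal (A * ((2 : ℝ) ^ (-s)) ^ k) * I := by
    intro k
    have h2k : (0 : ℝ) < 2 ^ k := by positivity
    have h1 := lintegral_norm_sq_mhat_mul_gaussian μ h2k
    have hmI : Measurable fun ξ : V =>
        ENNReal.ofReal (‖mhat μ ξ‖ ^ 2 * (1 + ‖ξ‖) ^ (s - (D : ℝ))) := by
      have := (continuous_mhat μ).measurable
      fun_prop
    have h2 : ∫⁻ ξ : V, ENNReal.ofReal (‖mhat μ ξ‖ ^ 2 *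
          Real.exp (-Real.pi * ‖ξ‖ ^ 2 / ((2 : ℝ) ^ k) ^ 2))
        ≤ ENNReal.ofReal (A * ((2 : ℝ) ^ k) ^ ((D : ℝ) - s)) * I := by
      rw [hI, ← lintegral_const_mul _ hmI]
      refine lintegral_mono fun ξ => ?_
      rw [← ENNReal.ofReal_mul (by positivity)]
      refine ENNReal.ofReal_le_ofReal ?_
      set t := ‖ξ‖ / 2 ^ k with ht
      have ht0 : 0 ≤ t := by positivity
      have hDs : 0 ≤ (D : ℝ) - s := by linarith
      have h3 : 1 + ‖ξ‖ ≤ 2 ^ k * (1 + t) := by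
        have h4 : (1 : ℝ) ≤ 2 ^ k := one_le_pow₀ one_le_two
        have h5 : 2 ^ k * t = ‖ξ‖ := by rw [ht]; field_simp
        rw [mul_add, h5]
        linarith
      have h4 : (1 + t) ^ ((D : ℝ) - s) ≤ Real.exp (((D : ℝ) - s) * t) := by
        rw [mul_comm, Real.exp_mul]
        refine Real.rpow_le_rpow (by positivity) ?_ hDs
        linarith [Real.add_one_le_exp t]
      have h5 : Real.exp (-Real.pi * ‖ξ‖ ^ 2 / ((2 : ℝ) ^ k) ^ 2) * (1 + t) ^ ((D : ℝ) - s) ≤ A := by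
        calc _ ≤ Real.exp (-Real.pi * ‖ξ‖ ^ 2 / ((2 : ℝ) ^ k) ^ 2) *
              Real.exp (((D : ℝ) - s) * t) := by gcongr
          _ ≤ A := by
            rw [← Real.exp_add, hA]
            refine Real.exp_le_exp.2 ?_
            rw [mul_div_assoc, ← div_pow, ← ht]
            nlinarith [Real.pi_gt_three, sq_nonneg (t - ((D : ℝ) - s)), sq_nonneg t,
              sq_nonneg ((D : ℝ) - s)]
      have h6 : Real.exp (-Real.pi * ‖ξ‖ ^ 2 / ((2 : ℝ) ^ k) ^ 2) * (1 + ‖ξ‖) ^ ((D : ℝ) - s)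
          ≤ A * ((2 : ℝ) ^ k) ^ ((D : ℝ) - s) := by
        calc _ ≤ Real.exp (-Real.pi * ‖ξ‖ ^ 2 / ((2 : ℝ) ^ k) ^ 2) *
              (2 ^ k * (1 + t)) ^ ((D : ℝ) - s) := by gcongr
          _ = (Real.exp (-Real.pi * ‖ξ‖ ^ 2 / ((2 : ℝ) ^ k) ^ 2) * (1 + t) ^ ((D : ℝ) - s)) *
              ((2 : ℝ) ^ k) ^ ((D : ℝ) - s) := by
            rw [Real.mul_rpow h2k.le (by positivity)]; ring
          _ ≤ _ := by gcongr
      have hpos : 0 < 1 + ‖ξ‖ := by positivity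
      calc ‖mhat μ ξ‖ ^ 2 * Real.exp (-Real.pi * ‖ξ‖ ^ 2 / ((2 : ℝ) ^ k) ^ 2)
          = ‖mhat μ ξ‖ ^ 2 * (Real.exp (-Real.pi * ‖ξ‖ ^ 2 / ((2 : ℝ) ^ k) ^ 2) *
              (1 + ‖ξ‖) ^ ((D : ℝ) - s)) * (1 + ‖ξ‖) ^ (s - (D : ℝ)) := by
            have h7 : (1 + ‖ξ‖) ^ ((D : ℝ) - s) * (1 + ‖ξ‖) ^ (s - (D : ℝ)) = 1 := by
              rw [← Real.rpow_add hpos, show (D : ℝ) - s + (s - D) = 0 by ring, Real.rpow_zero]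
            linear_combination -(‖mhat μ ξ‖ ^ 2 *
              Real.exp (-Real.pi * ‖ξ‖ ^ 2 / ((2 : ℝ) ^ k) ^ 2)) * h7
        _ ≤ ‖mhat μ ξ‖ ^ 2 * (A * ((2 : ℝ) ^ k) ^ ((D : ℝ) - s)) * (1 + ‖ξ‖) ^ (s - (D : ℝ)) := by
            gcongr
        _ = _ := by ring
    rw [h1] at h2
    have hne : ENNReal.ofReal (((2 : ℝ) ^ k) ^ D) ≠ 0 := by
      simp
    rw [mul_comm, ← ENNReal.le_div_iff_mul_le (Or.inl hne) (Or.inl ENNReal.ofReal_ne_top)] at h2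
    refine h2.trans (le_of_eq ?_)
    rw [ENNReal.mul_div_right_comm, ← ENNReal.ofReal_div_of_pos (by positivity)]
    congr 2
    rw [mul_div_assoc, Real.rpow_sub h2k, Real.rpow_natCast, ← Real.rpow_natCast 2 k,
      ← Real.rpow_mul two_pos.le, ← Real.rpow_natCast ((2 : ℝ) ^ (-s)) k,
      ← Real.rpow_mul two_pos.le, show -s * (k : ℝ) = -((k : ℝ) * s) by ring,
      Real.rpow_neg two_pos.le]
    have : ((2 : ℝ) ^ (k : ℝ)) ^ D ≠ 0 := by positivity
    field_simp
  have hq : (2 : ℝ) ^ (u - s) < 1 := Real.rpow_lt_one_of_one_lt_of_neg one_lt_two (by linarith)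
  refine ne_of_lt ?_
  calc ∑' k : ℕ, ENNReal.ofReal (((2 : ℝ) ^ u) ^ k) * ∫⁻ x, μ (Metric.ball x ((2 : ℝ) ^ k)⁻¹) ∂μ
      ≤ ∑' k : ℕ, ENNReal.ofReal (Real.exp Real.pi * A * ((2 : ℝ) ^ (u - s)) ^ k) * I := by
        refine ENNReal.tsum_le_tsum fun k => ?_
        refine (mul_le_mul_right ((hball k).trans (mul_le_mul_right (henergy k) _)) _).trans
          (le_of_eq ?_)
        rw [← mul_assoc, ← mul_assoc, ← ENNReal.ofReal_mul (by positivity),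
          ← ENNReal.ofReal_mul (by positivity)]
        congr 2
        rw [sub_eq_add_neg, Real.rpow_add two_pos, mul_pow]
        ring
    _ = ENNReal.ofReal (∑' k : ℕ, Real.exp Real.pi * A * ((2 : ℝ) ^ (u - s)) ^ k) * I := by
        rw [ENNReal.tsum_mul_right, ← ENNReal.ofReal_tsum_of_nonneg (fun k => by positivity)
          ((summable_geometric_of_lt_one (by positivity) hq).mul_left _)]
    _ < ∞ := ENNReal.mul_lt_top ENNReal.ofReal_lt_top h

end Energy

/-! ### Fourier decay of scalar products -/

section Decay

open Filter Topology

theorem sq_lintegral_le {α : Type*} [MeasurableSpace α] (m : Measure α) {f : α → ℝ≥0∞}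
    (hf : AEMeasurable f m) : (∫⁻ x, f x ∂m) ^ 2 ≤ m Set.univ * ∫⁻ x, f x ^ 2 ∂m := by
  have h := ENNReal.lintegral_mul_le_Lp_mul_Lq m Real.HolderConjugate.two_two hf
    (aemeasurable_const (b := (1 : ℝ≥0∞)))
  have h1 : ∫⁻ x, f x ∂m ≤ (∫⁻ x, f x ^ 2 ∂m) ^ (1 / 2 : ℝ) * (m Set.univ) ^ (1 / 2 : ℝ) := by
    simpa using h
  refine (pow_le_pow_left' h1 2).trans (le_of_eq ?_)
  rw [mul_pow, ← ENNReal.rpow_natCast, ← ENNReal.rpow_natCast, ← ENNReal.rpow_mul,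
    ← ENNReal.rpow_mul]
  norm_num
  rw [mul_comm]

theorem rpow_le_mul_rpow {x y B : ℝ} (hx : 0 < x) (hy : 0 < y) (hB : 0 < B) (hxy : x ≤ B * y)
    (hyx : y ≤ B * x) (e : ℝ) : x ^ e ≤ B ^ |e| * y ^ e := by
  rcases le_total 0 e with he | he
  · rw [abs_of_nonneg he, ← Real.mul_rpow hB.le hy.le]
    exact Real.rpow_le_rpow hx.le hxy he
  · rw [abs_of_nonpos he, Real.rpow_neg hB.le, ← Real.inv_rpow hB.le,
      ← Real.mul_rpow (by positivity) hy.le]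
    refine Real.rpow_le_rpow_of_nonpos (by positivity) ?_ he
    rw [inv_mul_le_iff₀ hB]
    exact hyx

/-- A measure on the line multiplied by the density `exp (-πr²)`. -/
noncomputable def gaussianDamp (ν : Measure ℝ) : Measure ℝ :=
  ν.withDensity fun r => ENNReal.ofReal (Real.exp (-Real.pi * r ^ 2))

instance (ν : Measure ℝ) [IsFiniteMeasure ν] : IsFiniteMeasure (gaussianDamp ν) := by
  refine isFiniteMeasure_withDensity (ne_of_lt ?_)
  refine (lintegral_mono (g := fun _ => 1) fun r => ?_).trans_lt
    (by simp)
  refine ENNReal.ofReal_le_one.2 (Real.exp_le_one_iff.2 ?_)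
  have := Real.pi_pos
  nlinarith [sq_nonneg r]

theorem integral_gaussian_eq_one (V : Type*) [NormedAddCommGroup V] [InnerProductSpace ℝ V]
    [FiniteDimensional ℝ V] [MeasurableSpace V] [BorelSpace V] {R : ℝ} (hR : 0 < R) :
    ∫ ξ : V, Real.exp (-Real.pi * ‖ξ‖ ^ 2 / R ^ 2) = R ^ Module.finrank ℝ V := by
  have h := integral_gaussian_mul_fourierExp (V := V) hR 0
  have h1 : fourierExp 0 = 1 := by simp [fourierExp]
  simp only [inner_zero_right, h1, mul_one, norm_zero] at h
  rw [integral_complex_ofReal, Complex.ofReal_inj] at h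
  rw [h]
  simp

/-- The transform of a damped measure is a Gaussian average of the original transform. -/
theorem mhat_gaussianDamp (ν : Measure ℝ) [IsFiniteMeasure ν] (s : ℝ) :
    mhat (gaussianDamp ν) s
      = ∫ v : ℝ, ((Real.exp (-Real.pi * v ^ 2) : ℝ) : ℂ) * mhat ν (s + v) := by
  have hg : Integrable fun v : ℝ => Real.exp (-Real.pi * v ^ 2) := by
    simpa using integrable_gaussian (V := ℝ) one_pos
  have h1 : ∀ r : ℝ, ((Real.exp (-Real.pi * r ^ 2) : ℝ) : ℂ)
      = ∫ v : ℝ, ((Real.exp (-Real.pi * v ^ 2) : ℝ) : ℂ) * fourierExp (inner ℝ v r) := fun r => by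
    have := integral_gaussian_mul_fourierExp (V := ℝ) one_pos r
    simp only [one_pow, div_one, mul_one, one_mul, Real.norm_eq_abs, sq_abs] at this
    exact this.symm
  rw [mhat, gaussianDamp, integral_withDensity_eq_integral_toReal_smul (by fun_prop)
    (Eventually.of_forall fun r => ENNReal.ofReal_lt_top)]
  simp_rw [ENNReal.toReal_ofReal (Real.exp_pos _).le, Complex.real_smul]
  calc ∫ r, ((Real.exp (-Real.pi * r ^ 2) : ℝ) : ℂ) * fourierExp (inner ℝ s r) ∂ν
      = ∫ r, (∫ v : ℝ, ((Real.exp (-Real.pi * v ^ 2) : ℝ) : ℂ) *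
          fourierExp (inner ℝ (s + v) r)) ∂ν := by
        refine integral_congr_ae (Eventually.of_forall fun r => ?_)
        simp only
        rw [h1 r, ← integral_mul_const]
        refine integral_congr_ae (Eventually.of_forall fun v => ?_)
        simp only
        rw [inner_add_left, fourierExp_add]
        ring
    _ = ∫ v : ℝ, (∫ r, ((Real.exp (-Real.pi * v ^ 2) : ℝ) : ℂ) *
          fourierExp (inner ℝ (s + v) r) ∂ν) := by
        refine integral_integral_swap ?_
        refine (hg.comp_snd ν).mono ?_ (Eventually.of_forall fun z => ?_)
        · refine Continuous.aestronglyMeasurable ?_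
          exact (by fun_prop : Continuous fun z : ℝ × ℝ =>
            ((Real.exp (-Real.pi * z.2 ^ 2) : ℝ) : ℂ)).mul
              (continuous_fourierExp.comp (by fun_prop))
        · simp only [Function.uncurry]
          rw [norm_mul, norm_fourierExp, mul_one, Complex.norm_real]
    _ = _ := by simp_rw [integral_const_mul, mhat]

/-- The purpose of the damping: the transform becomes an average of `mhat ν` against a Gaussian of
total mass one, so Cauchy–Schwarz bounds a pointwise value by a local `L²` mean. -/
theorem enorm_sq_mhat_gaussianDamp_le (ν : Measure ℝ) [IsFiniteMeasure ν] (s : ℝ) :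
    ‖mhat (gaussianDamp ν) s‖ₑ ^ 2
      ≤ ∫⁻ v : ℝ, ENNReal.ofReal (Real.exp (-Real.pi * (v - s) ^ 2)) * ‖mhat ν v‖ₑ ^ 2 := by
  have hg : Integrable fun v : ℝ => Real.exp (-Real.pi * v ^ 2) := by
    simpa using integrable_gaussian (V := ℝ) one_pos
  have hg1 : ∫⁻ v : ℝ, ENNReal.ofReal (Real.exp (-Real.pi * v ^ 2)) = 1 := by
    rw [← ofReal_integral_eq_lintegral_ofReal hg (Eventually.of_forall fun v => by positivity)]
    have := integral_gaussian_eq_one ℝ one_pos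
    simp only [one_pow, div_one, Real.norm_eq_abs, sq_abs] at this
    rw [this, ENNReal.ofReal_one]
  have hgm : Measurable fun v : ℝ => ENNReal.ofReal (Real.exp (-Real.pi * v ^ 2)) := by fun_prop
  have hmm : Measurable fun v : ℝ => ‖mhat ν (s + v)‖ₑ :=
    ((continuous_mhat ν).measurable.comp (measurable_const_add s)).enorm
  set m : Measure ℝ := volume.withDensity fun v => ENNReal.ofReal (Real.exp (-Real.pi * v ^ 2))
    with hm
  have h1 : ‖mhat (gaussianDamp ν) s‖ₑ ≤ ∫⁻ v, ‖mhat ν (s + v)‖ₑ ∂m := by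
    rw [mhat_gaussianDamp, hm, lintegral_withDensity_eq_lintegral_mul _ hgm hmm]
    refine (enorm_integral_le_lintegral_enorm _).trans (le_of_eq ?_)
    refine lintegral_congr fun v => ?_
    rw [enorm_mul, Pi.mul_apply]
    congr 1
    rw [← ofReal_norm, Complex.norm_real, Real.norm_of_nonneg (Real.exp_pos _).le]
  calc ‖mhat (gaussianDamp ν) s‖ₑ ^ 2 ≤ (∫⁻ v, ‖mhat ν (s + v)‖ₑ ∂m) ^ 2 := by gcongr
    _ ≤ m Set.univ * ∫⁻ v, ‖mhat ν (s + v)‖ₑ ^ 2 ∂m := sq_lintegral_le m hmm.aemeasurable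
    _ = ∫⁻ v : ℝ, ENNReal.ofReal (Real.exp (-Real.pi * v ^ 2)) * ‖mhat ν (s + v)‖ₑ ^ 2 := by
        rw [hm, withDensity_apply _ MeasurableSet.univ, Measure.restrict_univ, hg1, one_mul,
          lintegral_withDensity_eq_lintegral_mul _ hgm (hmm.pow_const 2)]
        rfl
    _ = _ := by
        rw [← lintegral_add_left_eq_self _ (-s)]
        refine lintegral_congr fun v => ?_
        rw [show s + (-s + v) = v by ring, show -s + v = v - s by ring]

variable {V : Type*} [NormedAddCommGroup V] [InnerProductSpace ℝ V] [FiniteDimensional ℝ V]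
  [MeasurableSpace V] [BorelSpace V]

/-- A Gaussian slab has volume `O(1 / ‖ξ‖)`. -/
theorem lintegral_gaussian_slab_le {ξ : V} (hξ : 0 < ‖ξ‖) (v : ℝ) :
    ∫⁻ y : V, ENNReal.ofReal (Real.exp (-(Real.pi / 4) * (v - inner ℝ ξ y) ^ 2) *
      Real.exp (-Real.pi * ‖y‖ ^ 2)) ≤ ENNReal.ofReal (2 * ‖ξ‖⁻¹) := by
  have hg : Integrable fun y : V => Real.exp (-Real.pi * ‖y‖ ^ 2) := by
    simpa using integrable_gaussian (V := V) one_pos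
  have hg2 : Integrable fun t : ℝ => Real.exp (-Real.pi * ‖t‖ ^ 2 / (1 / 2) ^ 2) :=
    integrable_gaussian (V := ℝ) (by norm_num)
  -- Writing the slab profile as a Fourier integral in `t` makes the `y`-integral an explicit
  -- Gaussian in `t • ξ`, and integrating that over `t` yields `‖ξ‖⁻¹`.
  have h1 : ∀ w : ℝ, ((Real.exp (-(Real.pi / 4) * w ^ 2) : ℝ) : ℂ)
      = 2 * ∫ t : ℝ, ((Real.exp (-Real.pi * ‖t‖ ^ 2 / (1 / 2) ^ 2) : ℝ) : ℂ) *
        fourierExp (inner ℝ t w) := fun w => by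
    rw [integral_gaussian_mul_fourierExp (V := ℝ) (by norm_num : (0 : ℝ) < 1 / 2) w]
    simp only [Module.finrank_self, pow_one, Real.norm_eq_abs, sq_abs]
    rw [show -(Real.pi / 4) * w ^ 2 = -Real.pi * (1 / 2) ^ 2 * w ^ 2 by ring]
    push_cast
    ring
  have hint : Integrable fun y : V => Real.exp (-(Real.pi / 4) * (v - inner ℝ ξ y) ^ 2) *
      Real.exp (-Real.pi * ‖y‖ ^ 2) := by
    refine hg.bdd_mul (Continuous.aestronglyMeasurable (by fun_prop)) (c := 1)
      (Eventually.of_forall fun y => ?_)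
    rw [Real.norm_of_nonneg (Real.exp_pos _).le, Real.exp_le_one_iff]
    have := Real.pi_pos
    nlinarith [sq_nonneg (v - inner ℝ ξ y)]
  have hy : ∀ t : ℝ, ∫ y : V, ((Real.exp (-Real.pi * ‖y‖ ^ 2) : ℝ) : ℂ) *
      fourierExp (inner ℝ t (v - inner ℝ ξ y))
      = fourierExp (inner ℝ t v) * ((Real.exp (-Real.pi * ‖t • ξ‖ ^ 2) : ℝ) : ℂ) := by
    intro t
    have h2 := integral_gaussian_mul_fourierExp (V := V) one_pos (-(t • ξ))
    simp only [one_pow, div_one, mul_one, one_mul, norm_neg] at h2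
    rw [← h2, ← integral_const_mul]
    refine integral_congr_ae (Eventually.of_forall fun y => ?_)
    simp only
    rw [inner_sub_right, sub_eq_add_neg, fourierExp_add, inner_neg_right, real_inner_smul_right,
      real_inner_comm ξ y]
    have : inner ℝ t (inner ℝ ξ y : ℝ) = t * inner ℝ ξ y := by
      simp [mul_comm]
    rw [this]
    ring
  have hmain : ((∫ y : V, Real.exp (-(Real.pi / 4) * (v - inner ℝ ξ y) ^ 2) *
      Real.exp (-Real.pi * ‖y‖ ^ 2) : ℝ) : ℂ)
      = 2 * ∫ t : ℝ, ((Real.exp (-Real.pi * ‖t‖ ^ 2 / (1 / 2) ^ 2) : ℝ) : ℂ) *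
        (fourierExp (inner ℝ t v) * ((Real.exp (-Real.pi * ‖t • ξ‖ ^ 2) : ℝ) : ℂ)) := by
    rw [← integral_complex_ofReal]
    calc ∫ y : V, ((Real.exp (-(Real.pi / 4) * (v - inner ℝ ξ y) ^ 2) *
          Real.exp (-Real.pi * ‖y‖ ^ 2) : ℝ) : ℂ)
        = ∫ y : V, 2 * ∫ t : ℝ, ((Real.exp (-Real.pi * ‖t‖ ^ 2 / (1 / 2) ^ 2) : ℝ) : ℂ) *
            (((Real.exp (-Real.pi * ‖y‖ ^ 2) : ℝ) : ℂ) *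
              fourierExp (inner ℝ t (v - inner ℝ ξ y))) := by
          refine integral_congr_ae (Eventually.of_forall fun y => ?_)
          simp only
          rw [Complex.ofReal_mul, h1, mul_assoc, ← integral_mul_const]
          congr 1
          refine integral_congr_ae (Eventually.of_forall fun t => ?_)
          simp only
          ring
      _ = 2 * ∫ t : ℝ, ∫ y : V, ((Real.exp (-Real.pi * ‖t‖ ^ 2 / (1 / 2) ^ 2) : ℝ) : ℂ) *
            (((Real.exp (-Real.pi * ‖y‖ ^ 2) : ℝ) : ℂ) *
              fourierExp (inner ℝ t (v - inner ℝ ξ y))) := by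
          rw [integral_const_mul]
          congr 1
          refine integral_integral_swap ?_
          refine (hg.mul_prod hg2).mono ?_ (Eventually.of_forall fun z => ?_)
          · refine Continuous.aestronglyMeasurable ?_
            exact (by fun_prop : Continuous fun z : V × ℝ =>
              ((Real.exp (-Real.pi * ‖z.2‖ ^ 2 / (1 / 2) ^ 2) : ℝ) : ℂ)).mul
                ((by fun_prop : Continuous fun z : V × ℝ =>
                  ((Real.exp (-Real.pi * ‖z.1‖ ^ 2) : ℝ) : ℂ)).mul
                (continuous_fourierExp.comp (by fun_prop)))
          · simp only [Function.uncurry]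
            rw [norm_mul, norm_mul, norm_fourierExp, mul_one, Complex.norm_real, Complex.norm_real,
              norm_mul, mul_comm]
      _ = _ := by simp_rw [integral_const_mul, hy]
  have hR := integral_gaussian_eq_one ℝ (inv_pos.2 hξ)
  have hRi := integrable_gaussian (V := ℝ) (inv_pos.2 hξ)
  rw [← ofReal_integral_eq_lintegral_ofReal hint (Eventually.of_forall fun y => by positivity)]
  refine ENNReal.ofReal_le_ofReal ?_
  calc ∫ y : V, Real.exp (-(Real.pi / 4) * (v - inner ℝ ξ y) ^ 2) * Real.exp (-Real.pi * ‖y‖ ^ 2)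
      ≤ ‖((∫ y : V, Real.exp (-(Real.pi / 4) * (v - inner ℝ ξ y) ^ 2) *
          Real.exp (-Real.pi * ‖y‖ ^ 2) : ℝ) : ℂ)‖ := by
        rw [Complex.norm_real]
        exact le_abs_self _
    _ ≤ 2 * ∫ t : ℝ, Real.exp (-Real.pi * ‖t‖ ^ 2 / ‖ξ‖⁻¹ ^ 2) := by
        rw [hmain, norm_mul, Complex.norm_ofNat]
        gcongr
        refine norm_integral_le_of_norm_le hRi (Eventually.of_forall fun t => ?_)
        rw [norm_mul, norm_mul, norm_fourierExp, one_mul, Complex.norm_real, Complex.norm_real,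
          Real.norm_of_nonneg (Real.exp_pos _).le, Real.norm_of_nonneg (Real.exp_pos _).le]
        have h3 : Real.exp (-Real.pi * ‖t‖ ^ 2 / (1 / 2) ^ 2) ≤ 1 := by
          rw [Real.exp_le_one_iff]
          have := Real.pi_pos
          have : 0 ≤ Real.pi * ‖t‖ ^ 2 / (1 / 2) ^ 2 := by positivity
          rw [neg_mul, neg_div]
          linarith
        refine (mul_le_of_le_one_left (Real.exp_pos _).le h3).trans (le_of_eq ?_)
        congr 1
        rw [norm_smul]
        field_simp
    _ = 2 * ‖ξ‖⁻¹ := by rw [hR]; simp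

/-- Slabs of width `1 / ‖ξ‖` have Frostman measure `O(‖ξ‖ ^ (d - 1 - a))`. -/
theorem IsFrostman.lintegral_slab_le {μ : Measure V} [IsFiniteMeasure μ] {a M : ℝ}
    (hμ : IsFrostman μ a) (hM : ∀ᵐ x ∂μ, ‖x‖ ≤ M) :
    ∃ C : ℝ, 0 ≤ C ∧ ∀ (ξ : V) (v : ℝ), 1 ≤ ‖ξ‖ →
      ∫⁻ x, ENNReal.ofReal (Real.exp (-(Real.pi / 2) * (v - inner ℝ ξ x) ^ 2)) ∂μ
        ≤ ENNReal.ofReal (C * ‖ξ‖ ^ ((Module.finrank ℝ V : ℝ) - 1 - a)) := by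
  obtain ⟨C, hC0, hC⟩ := hμ
  set D := Module.finrank ℝ V with hD
  set c : ℝ := (volume (Metric.ball (0 : V) 1)).toReal with hc
  have hcpos : 0 < c := ENNReal.toReal_pos (Metric.measure_ball_pos volume 0 one_pos).ne'
    measure_ball_lt_top.ne
  -- Cost of moving from `x` to `y` with `‖y - x‖ < 1 / ‖ξ‖`: the inner product with `ξ` changes by
  -- at most `1`, so the profile constant drops from `π/2` to `π/4` with a loss `exp (π/2)`; the
  -- rest absorbs the cutoff `exp (-π ‖y‖²)`.
  set B : ℝ := Real.exp (Real.pi / 2 + Real.pi * (M + 1) ^ 2) with hB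
  refine ⟨2 * B * C / c, by positivity, fun ξ v hξ => ?_⟩
  have hξ0 : 0 < ‖ξ‖ := by linarith
  set δ : ℝ := ‖ξ‖⁻¹ with hδ
  have hδ0 : 0 < δ := by positivity
  have hδ1 : δ ≤ 1 := inv_le_one_of_one_le₀ hξ
  have hvol : ∀ x : V, volume (Metric.ball x δ) = ENNReal.ofReal (c * δ ^ D) := fun x => by
    rw [Measure.addHaar_ball_of_pos _ _ hδ0, mul_comm c, ENNReal.ofReal_mul (by positivity), hc,
      ENNReal.ofReal_toReal measure_ball_lt_top.ne]
  set G : V → ℝ≥0∞ := fun y => ENNReal.ofReal (Real.exp (-(Real.pi / 4) * (v - inner ℝ ξ y) ^ 2) *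
    Real.exp (-Real.pi * ‖y‖ ^ 2)) with hG
  have hGm : Measurable G := by fun_prop
  have hpt : ∀ᵐ x ∂μ, ENNReal.ofReal (Real.exp (-(Real.pi / 2) * (v - inner ℝ ξ x) ^ 2)) *
      ENNReal.ofReal (c * δ ^ D)
      ≤ ∫⁻ y, (Metric.ball x δ).indicator (fun y => ENNReal.ofReal B * G y) y := by
    filter_upwards [hM] with x hx
    rw [← hvol x, ← lintegral_indicator_const Metric.isOpen_ball.measurableSet]
    refine lintegral_mono fun y => ?_
    by_cases hy : y ∈ Metric.ball x δ
    · rw [Set.indicator_of_mem hy, Set.indicator_of_mem hy, hG]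
      simp only
      rw [← ENNReal.ofReal_mul (Real.exp_pos _).le, ← Real.exp_add, ← Real.exp_add]
      refine ENNReal.ofReal_le_ofReal (Real.exp_le_exp.2 ?_)
      rw [Metric.mem_ball, dist_eq_norm] at hy
      have h1 : |inner ℝ ξ (y - x)| ≤ 1 := by
        refine (abs_real_inner_le_norm _ _).trans ?_
        calc ‖ξ‖ * ‖y - x‖ ≤ ‖ξ‖ * δ := by gcongr
          _ = 1 := mul_inv_cancel₀ hξ0.ne'
      have h2 : (inner ℝ ξ y - inner ℝ ξ x : ℝ) ^ 2 ≤ 1 := by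
        rw [← inner_sub_right, ← sq_abs]
        exact pow_le_one₀ (abs_nonneg _) h1
      have h3 : ‖y‖ ≤ M + 1 := by
        have := norm_add_le x (y - x)
        rw [add_sub_cancel] at this
        linarith
      have h4 : ‖y‖ ^ 2 ≤ (M + 1) ^ 2 := by gcongr
      have h5 : (v - inner ℝ ξ y) ^ 2 ≤ 2 * (v - inner ℝ ξ x) ^ 2 + 2 := by
        nlinarith [sq_nonneg (v - inner ℝ ξ x + (inner ℝ ξ y - inner ℝ ξ x))]
      have hπ := Real.pi_pos
      nlinarith
    · rw [Set.indicator_of_notMem hy, Set.indicator_of_notMem hy]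
  have hcδ : ENNReal.ofReal (c * δ ^ D) ≠ 0 := by
    simpa using (by positivity : 0 < c * δ ^ D)
  -- Averaging over balls of radius `δ` and exchanging the integrals replaces a covering of the
  -- slab: the slab volume `2 δ` times the ball mass `C δ ^ a` is divided by the ball volume `c δ ^
  -- D`.
  have hprod : ∫⁻ x, ∫⁻ y, (Metric.ball x δ).indicator (fun y => ENNReal.ofReal B * G y) y ∂volume ∂μ
      = ∫⁻ y, ENNReal.ofReal B * G y * μ (Metric.ball y δ) := by
    have hset : MeasurableSet {p : V × V | dist p.2 p.1 < δ} :=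
      (isOpen_lt (by fun_prop) continuous_const).measurableSet
    rw [lintegral_lintegral_swap]
    · refine lintegral_congr fun y => ?_
      rw [← lintegral_indicator_const Metric.isOpen_ball.measurableSet]
      refine lintegral_congr fun x => ?_
      by_cases h : x ∈ Metric.ball y δ
      · rw [Set.indicator_of_mem h, Set.indicator_of_mem (Metric.mem_ball_comm.1 h)]
      · rw [Set.indicator_of_notMem h,
          Set.indicator_of_notMem fun h' => h (Metric.mem_ball_comm.1 h')]
    · refine Measurable.aemeasurable ?_
      have : (Function.uncurry fun x y => (Metric.ball x δ).indicator
          (fun y => ENNReal.ofReal B * G y) y)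
          = {p : V × V | dist p.2 p.1 < δ}.indicator
            fun p => ENNReal.ofReal B * G p.2 := by
        ext p
        rfl
      rw [this]
      exact ((hGm.comp measurable_snd).const_mul _).indicator hset
  have hfin : (∫⁻ x, ENNReal.ofReal (Real.exp (-(Real.pi / 2) * (v - inner ℝ ξ x) ^ 2)) ∂μ) *
      ENNReal.ofReal (c * δ ^ D) ≤ ENNReal.ofReal (B * (C * δ ^ a) * (2 * δ)) := by
    rw [← lintegral_mul_const _ (by fun_prop)]
    refine (lintegral_mono_ae hpt).trans ?_
    rw [hprod]
    calc ∫⁻ y, ENNReal.ofReal B * G y * μ (Metric.ball y δ)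
        ≤ ∫⁻ y, ENNReal.ofReal (B * (C * δ ^ a)) * G y := by
          refine lintegral_mono fun y => ?_
          rw [ENNReal.ofReal_mul (Real.exp_pos _).le, mul_right_comm]
          gcongr
          exact hC y δ hδ0
      _ = ENNReal.ofReal (B * (C * δ ^ a)) * ∫⁻ y, G y := lintegral_const_mul _ hGm
      _ ≤ ENNReal.ofReal (B * (C * δ ^ a)) * ENNReal.ofReal (2 * δ) := by
          gcongr
          exact lintegral_gaussian_slab_le hξ0 v
      _ = _ := by rw [← ENNReal.ofReal_mul (by positivity)]
  rw [← ENNReal.le_div_iff_mul_le (Or.inl hcδ) (Or.inl ENNReal.ofReal_ne_top)] at hfin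
  refine hfin.trans (le_of_eq ?_)
  rw [← ENNReal.ofReal_div_of_pos (by positivity)]
  congr 1
  rw [hδ, Real.rpow_sub hξ0, Real.rpow_sub hξ0, Real.rpow_natCast, Real.rpow_one,
    Real.inv_rpow hξ0.le, inv_pow]
  have : ‖ξ‖ ^ a ≠ 0 := by positivity
  field_simp

theorem mhat_map_smul (ν : Measure ℝ) [IsFiniteMeasure ν] (μ : Measure V) [IsFiniteMeasure μ]
    (ξ : V) : mhat ((ν.prod μ).map fun p => p.1 • p.2) ξ = ∫ x, mhat ν (inner ℝ ξ x) ∂μ := by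
  have hc : Continuous fun x : V => fourierExp (inner ℝ ξ x) :=
    continuous_fourierExp.comp (by fun_prop)
  rw [mhat, integral_map (by fun_prop) hc.aestronglyMeasurable, integral_prod_symm]
  · refine integral_congr_ae (Eventually.of_forall fun x => ?_)
    simp only
    rw [mhat]
    refine integral_congr_ae (Eventually.of_forall fun r => ?_)
    simp only
    rw [real_inner_smul_right]
    congr 1
  · exact Integrable.of_bound (continuous_fourierExp.comp (by fun_prop)).aestronglyMeasurable 1
      (Eventually.of_forall fun x => (norm_fourierExp _).le)

/-- Fourier decay of the image of `ν × μ` under scalar multiplication. -/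
theorem norm_sq_mhat_map_smul_le {μ : Measure V} [IsFiniteMeasure μ] {a M : ℝ}
    (hμ : IsFrostman μ a) (hM : ∀ᵐ x ∂μ, ‖x‖ ≤ M) {ν : Measure ℝ} [IsFiniteMeasure ν] {τ : ℝ}
    (hν : IsFrostman ν τ) :
    ∃ C : ℝ, 0 ≤ C ∧ ∀ ξ : V, ‖mhat (((gaussianDamp ν).prod μ).map fun p => p.1 • p.2) ξ‖ ^ 2
      ≤ C * (1 + ‖ξ‖) ^ ((Module.finrank ℝ V : ℝ) - a - τ) := by
  obtain ⟨C₁, hC₁0, hC₁⟩ := hμ.lintegral_slab_le hM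
  obtain ⟨C₂, hC₂0, hC₂⟩ := hν.lintegral_norm_sq_mhat_mul_gaussian_le
  set D := Module.finrank ℝ V with hD
  set lam := ((gaussianDamp ν).prod μ).map fun p : ℝ × V => p.1 • p.2 with hlam
  set e : ℝ := (D : ℝ) - a - τ with he
  set m := μ.real Set.univ with hm
  set A := Real.exp (2 * Real.pi * M ^ 2) with hA
  have hlarge : ∀ ξ : V, 2 ≤ ‖ξ‖ → ‖mhat lam ξ‖ ^ 2 ≤ m * A * C₁ * C₂ * ‖ξ‖ ^ e := by
    intro ξ hξ
    have hξ0 : 0 < ‖ξ‖ := by linarith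
    have hmν : Measurable fun v => ‖mhat ν v‖ₑ ^ 2 :=
      (continuous_mhat ν).measurable.enorm.pow_const 2
    have hmg : Measurable fun v => ‖mhat (gaussianDamp ν) v‖ₑ :=
      (continuous_mhat (gaussianDamp ν)).measurable.enorm
    have h1 : ‖mhat lam ξ‖ₑ ^ 2
        ≤ μ Set.univ * ∫⁻ x, ‖mhat (gaussianDamp ν) (inner ℝ ξ x)‖ₑ ^ 2 ∂μ := by
      rw [hlam, mhat_map_smul]
      refine (pow_le_pow_left' (enorm_integral_le_lintegral_enorm _) 2).trans ?_
      exact sq_lintegral_le μ (hmg.comp (by fun_prop)).aemeasurable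
    have h2 : ∫⁻ x, ‖mhat (gaussianDamp ν) (inner ℝ ξ x)‖ₑ ^ 2 ∂μ
        ≤ ∫⁻ v : ℝ, ∫⁻ x, ENNReal.ofReal (Real.exp (-Real.pi * (v - inner ℝ ξ x) ^ 2)) *
          ‖mhat ν v‖ₑ ^ 2 ∂μ := by
      refine (lintegral_mono fun x => enorm_sq_mhat_gaussianDamp_le ν _).trans (le_of_eq ?_)
      refine lintegral_lintegral_swap (Measurable.aemeasurable ?_)
      exact Measurable.mul (by fun_prop) (hmν.comp measurable_snd)
    have h3 : ∀ v : ℝ, ∫⁻ x, ENNReal.ofReal (Real.exp (-Real.pi * (v - inner ℝ ξ x) ^ 2)) *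
          ‖mhat ν v‖ₑ ^ 2 ∂μ
        ≤ ENNReal.ofReal (A * (C₁ * ‖ξ‖ ^ ((D : ℝ) - 1 - a))) *
          ENNReal.ofReal (‖mhat ν v‖ ^ 2 * Real.exp (-Real.pi * ‖v‖ ^ 2 / ‖ξ‖ ^ 2)) := by
      intro v
      -- Half of the Gaussian is kept for the slab estimate. The other half is traded for a cutoff
      -- `|v| ≲ ‖ξ‖`, since `|ξ·x| ≤ M ‖ξ‖`; `‖ξ‖ ≥ 2` makes the constants fit.
      have h4 : ∀ᵐ x ∂μ, ENNReal.ofReal (Real.exp (-Real.pi * (v - inner ℝ ξ x) ^ 2))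
          ≤ ENNReal.ofReal (A * Real.exp (-Real.pi * ‖v‖ ^ 2 / ‖ξ‖ ^ 2)) *
            ENNReal.ofReal (Real.exp (-(Real.pi / 2) * (v - inner ℝ ξ x) ^ 2)) := by
        filter_upwards [hM] with x hx
        rw [← ENNReal.ofReal_mul (by positivity), hA, ← Real.exp_add, ← Real.exp_add]
        refine ENNReal.ofReal_le_ofReal (Real.exp_le_exp.2 ?_)
        set s : ℝ := inner ℝ ξ x with hs
        have h5 : s ^ 2 ≤ ‖ξ‖ ^ 2 * M ^ 2 := by
          rw [← sq_abs, ← mul_pow]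
          refine pow_le_pow_left₀ (abs_nonneg _) ((abs_real_inner_le_norm _ _).trans ?_) 2
          gcongr
        have h6 : v ^ 2 / ‖ξ‖ ^ 2 ≤ 2 * M ^ 2 + (1 / 2) * (v - s) ^ 2 := by
          rw [div_le_iff₀ (by positivity)]
          have h7 : (4 : ℝ) ≤ ‖ξ‖ ^ 2 := by nlinarith
          nlinarith [sq_nonneg (v - s - s), sq_nonneg (v - s),
            mul_le_mul_of_nonneg_right h7 (sq_nonneg (v - s))]
        have hπ := Real.pi_pos
        rw [Real.norm_eq_abs, sq_abs, mul_div_assoc]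
        nlinarith
      rw [lintegral_mul_const _ (by fun_prop)]
      calc (∫⁻ x, ENNReal.ofReal (Real.exp (-Real.pi * (v - inner ℝ ξ x) ^ 2)) ∂μ) *
            ‖mhat ν v‖ₑ ^ 2
          ≤ (ENNReal.ofReal (A * Real.exp (-Real.pi * ‖v‖ ^ 2 / ‖ξ‖ ^ 2)) *
              ENNReal.ofReal (C₁ * ‖ξ‖ ^ ((D : ℝ) - 1 - a))) * ‖mhat ν v‖ₑ ^ 2 := by
            gcongr
            refine (lintegral_mono_ae h4).trans ?_
            rw [lintegral_const_mul _ (by fun_prop)]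
            gcongr
            exact hC₁ ξ v (by linarith)
        _ = _ := by
            rw [← ofReal_norm, ← ENNReal.ofReal_pow (norm_nonneg _),
              ← ENNReal.ofReal_mul (by positivity), ← ENNReal.ofReal_mul (by positivity),
              ← ENNReal.ofReal_mul (by positivity)]
            congr 1
            ring
    have hmeas : Measurable fun v : ℝ => ENNReal.ofReal (‖mhat ν v‖ ^ 2 *
        Real.exp (-Real.pi * ‖v‖ ^ 2 / ‖ξ‖ ^ 2)) := by
      have := (continuous_mhat ν).measurable
      fun_prop
    have h8 : ENNReal.ofReal (‖mhat lam ξ‖ ^ 2)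
        ≤ ENNReal.ofReal (m * A * C₁ * C₂ * ‖ξ‖ ^ e) := by
      rw [ENNReal.ofReal_pow (norm_nonneg _), ofReal_norm]
      calc ‖mhat lam ξ‖ₑ ^ 2 ≤ μ Set.univ * (ENNReal.ofReal (A * (C₁ * ‖ξ‖ ^ ((D : ℝ) - 1 - a))) *
            ENNReal.ofReal (C₂ * ‖ξ‖ ^ ((Module.finrank ℝ ℝ : ℝ) - τ))) := by
            refine h1.trans (mul_le_mul_right (h2.trans ((lintegral_mono h3).trans ?_)) _)
            rw [lintegral_const_mul _ hmeas]
            gcongr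
            exact hC₂ ‖ξ‖ hξ0
        _ = _ := by
            rw [← ENNReal.ofReal_toReal (measure_ne_top μ Set.univ),
              ← ENNReal.ofReal_mul (by positivity), ← ENNReal.ofReal_mul (by positivity)]
            congr 1
            have h9 : ‖ξ‖ ^ e = ‖ξ‖ ^ ((D : ℝ) - 1 - a) * ‖ξ‖ ^ ((Module.finrank ℝ ℝ : ℝ) - τ) := by
              rw [← Real.rpow_add hξ0, he, Module.finrank_self]
              congr 1
              push_cast
              ring
            rw [h9, hm, Measure.real]
            ring
    exact (ENNReal.ofReal_le_ofReal_iff (by positivity)).1 h8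
  -- The first term serves `‖ξ‖ ≥ 2`; the second is the trivial total mass bound for `‖ξ‖ < 2`.
  -- Absolute values allow either sign of `e`.
  refine ⟨m * A * C₁ * C₂ * 2 ^ |e| + lam.real Set.univ ^ 2 * 3 ^ |e|, by positivity,
    fun ξ => ?_⟩
  have hpos : (0 : ℝ) < 1 + ‖ξ‖ := by positivity
  have hn := norm_nonneg ξ
  rw [add_mul]
  rcases le_or_gt 2 ‖ξ‖ with hξ | hξ
  · have h1 := rpow_le_mul_rpow (x := ‖ξ‖) (y := 1 + ‖ξ‖) (B := 2) (by linarith) hpos two_pos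
      (by linarith) (by linarith) e
    have h2 : m * A * C₁ * C₂ * ‖ξ‖ ^ e ≤ m * A * C₁ * C₂ * (2 ^ |e| * (1 + ‖ξ‖) ^ e) := by
      gcongr
    have h3 : 0 ≤ lam.real Set.univ ^ 2 * 3 ^ |e| * (1 + ‖ξ‖) ^ e := by positivity
    linarith [hlarge ξ hξ]
  · have h1 := rpow_le_mul_rpow (x := 1) (y := 1 + ‖ξ‖) (B := 3) one_pos hpos three_pos
      (by linarith) (by linarith) e
    rw [Real.one_rpow] at h1
    have h2 : ‖mhat lam ξ‖ ^ 2 ≤ lam.real Set.univ ^ 2 :=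
      pow_le_pow_left₀ (norm_nonneg _) (norm_mhat_le lam ξ) 2
    have h3 : lam.real Set.univ ^ 2 ≤ lam.real Set.univ ^ 2 * (3 ^ |e| * (1 + ‖ξ‖) ^ e) :=
      le_mul_of_one_le_right (by positivity) h1
    have h4 : 0 ≤ m * A * C₁ * C₂ * 2 ^ |e| * (1 + ‖ξ‖) ^ e := by positivity
    linarith

end Decay

/-! ### Square-integrable transforms and positive volume -/

section SquareIntegrable

open Filter Topology
open scoped FourierTransform SchwartzMap ContDiff Manifold

variable {V : Type*} [NormedAddCommGroup V] [InnerProductSpace ℝ V] [FiniteDimensional ℝ V]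
  [MeasurableSpace V] [BorelSpace V]

theorem integral_fourier_schwartz_eq (μ : Measure V) [IsFiniteMeasure μ] (g : 𝓢(V, ℂ)) :
    ∫ x, 𝓕 g x ∂μ = ∫ v, mhat μ v * g v := by
  have h1 : ∀ x, 𝓕 g x = ∫ v, fourierExp (inner ℝ v x) * g v := fun x => by
    rw [SchwartzMap.fourier_coe, Real.fourier_eq']
    refine integral_congr_ae (Eventually.of_forall fun v => ?_)
    simp only [smul_eq_mul, fourierExp]
    congr 2
    push_cast
    ring
  simp_rw [h1]
  rw [integral_integral_swap]
  · simp_rw [integral_mul_const, mhat]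
  · refine (g.integrable.comp_snd μ).mono ?_ (Eventually.of_forall fun z => ?_)
    · refine Continuous.aestronglyMeasurable ?_
      exact (continuous_fourierExp.comp (by fun_prop)).mul (g.continuous.comp continuous_snd)
    · simp only [Function.uncurry]
      rw [norm_mul, norm_fourierExp, one_mul]

/-- Moving the transform onto `μ`, then Cauchy–Schwarz and Plancherel for `g`: integration against
`μ` is bounded in the `L²` norm of the test function. -/
theorem enorm_sq_integral_fourier_schwartz_le (μ : Measure V) [IsFiniteMeasure μ] (g : 𝓢(V, ℂ)) :
    ‖∫ x, 𝓕 g x ∂μ‖ₑ ^ 2 ≤ (∫⁻ v, ‖mhat μ v‖ₑ ^ 2) * ∫⁻ x, ‖𝓕 g x‖ₑ ^ 2 := by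
  have h1 : ∀ f : 𝓢(V, ℂ), ∫⁻ x, ‖f x‖ₑ ^ 2 = ENNReal.ofReal (∫ x, ‖f x‖ ^ 2) := fun f => by
    rw [ofReal_integral_eq_lintegral_ofReal ((memLp_two_iff_integrable_sq_norm
      f.continuous.aestronglyMeasurable).1 (f.memLp 2 volume))
      (Eventually.of_forall fun x => by positivity)]
    simp_rw [ENNReal.ofReal_pow (norm_nonneg _), ofReal_norm]
  rw [h1 (𝓕 g), SchwartzMap.integral_norm_sq_fourier, ← h1 g, integral_fourier_schwartz_eq]
  have hm : AEMeasurable (fun v => ‖mhat μ v‖ₑ) volume :=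
    (continuous_mhat μ).measurable.enorm.aemeasurable
  have hg : AEMeasurable (fun v => ‖g v‖ₑ) volume := g.continuous.measurable.enorm.aemeasurable
  have h2 := ENNReal.lintegral_mul_le_Lp_mul_Lq volume Real.HolderConjugate.two_two hm hg
  have h3 : ‖∫ v, mhat μ v * g v‖ₑ ≤ (∫⁻ v, ‖mhat μ v‖ₑ ^ 2) ^ (1 / 2 : ℝ) *
      (∫⁻ v, ‖g v‖ₑ ^ 2) ^ (1 / 2 : ℝ) := by
    refine (enorm_integral_le_lintegral_enorm _).trans ?_
    simp_rw [enorm_mul]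
    simpa using h2
  refine (pow_le_pow_left' h3 2).trans (le_of_eq ?_)
  rw [mul_pow, ← ENNReal.rpow_natCast, ← ENNReal.rpow_natCast, ← ENNReal.rpow_mul,
    ← ENNReal.rpow_mul]
  norm_num

/-- A compact set carrying a measure with square-integrable Fourier transform has positive
Lebesgue measure. -/
theorem volume_pos_of_lintegral_norm_sq_mhat_lt_top {μ : Measure V} [IsFiniteMeasure μ]
    (hμ0 : μ ≠ 0) {K : Set V} (hK : IsCompact K) (hμK : μ Kᶜ = 0)
    (h : ∫⁻ v, ‖mhat μ v‖ₑ ^ 2 < (⊤ : ℝ≥0∞)) : 0 < volume K := by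
  by_contra hvol
  have hvol0 : volume K = 0 := by simpa using hvol
  set m := μ Set.univ with hm
  have hm0 : m ≠ 0 := by rwa [hm, Ne, Measure.measure_univ_eq_zero]
  set B := ∫⁻ v, ‖mhat μ v‖ₑ ^ 2 with hB
  -- If `K` were null, a smooth function equal to `1` on `K` and vanishing off an open set of volume
  -- at most `ε` would have `μ`-integral `m` but squared `L²` norm at most `ε`.
  have hkey : ∀ ε : ℝ≥0∞, ε ≠ 0 → m ^ 2 ≤ B * ε := by
    intro ε hε
    obtain ⟨U, hKU, hU, hUε⟩ := K.exists_isOpen_le_add volume hε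
    rw [hvol0, zero_add] at hUε
    obtain ⟨r, hr⟩ := hK.isBounded.subset_ball (0 : V)
    have hW : IsOpen (U ∩ Metric.ball 0 r) := hU.inter Metric.isOpen_ball
    obtain ⟨f, hf0, hf1, hf01⟩ := exists_contMDiffMap_zero_one_of_isClosed (n := ⊤) 𝓘(ℝ, V)
      hW.isClosed_compl hK.isClosed
      (Set.disjoint_left.2 fun x hx hxK => hx ⟨hKU hxK, hr hxK⟩)
    have hfc : ContDiff ℝ ∞ (fun x => (f x : ℂ)) :=
      Complex.ofRealCLM.contDiff.comp (contMDiff_iff_contDiff.1 f.contMDiff)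
    have hfs : HasCompactSupport fun x => (f x : ℂ) := by
      refine HasCompactSupport.intro' (K := Metric.closedBall (0 : V) r)
        (isCompact_closedBall _ _) Metric.isClosed_closedBall fun x hx => ?_
      have : f x = 0 := hf0 fun hx' => hx (Metric.ball_subset_closedBall hx'.2)
      simp [this]
    set F : 𝓢(V, ℂ) := hfs.toSchwartzMap hfc with hF
    have hFx : ∀ x, F x = (f x : ℂ) := fun x => rfl
    have h1 := enorm_sq_integral_fourier_schwartz_le μ (𝓕⁻ F)
    rw [FourierTransform.fourier_fourierInv_eq] at h1
    have h2 : ∫ x, F x ∂μ = ((μ.real Set.univ : ℝ) : ℂ) := by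
      have h3 : ∀ᵐ x ∂μ, F x = 1 := by
        filter_upwards [measure_eq_zero_iff_ae_notMem.1 hμK] with x hx
        have : f x = 1 := hf1 (by simpa using hx)
        rw [hFx, this, Complex.ofReal_one]
      rw [integral_congr_ae h3]
      simp
    have h3 : ‖∫ x, F x ∂μ‖ₑ = m := by
      rw [h2, ← ofReal_norm, Complex.norm_real, Real.norm_of_nonneg measureReal_nonneg, Measure.real,
        ENNReal.ofReal_toReal (measure_ne_top _ _)]
    have h4 : ∫⁻ x, ‖F x‖ₑ ^ 2 ≤ ε := by
      calc ∫⁻ x, ‖F x‖ₑ ^ 2 ≤ ∫⁻ x, U.indicator (fun _ => 1) x := by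
            refine lintegral_mono fun x => ?_
            by_cases hx : x ∈ U
            · rw [Set.indicator_of_mem hx, hFx, ← ofReal_norm, Complex.norm_real,
                Real.norm_of_nonneg (hf01 x).1]
              exact pow_le_one₀ zero_le (ENNReal.ofReal_le_one.2 (hf01 x).2)
            · have : f x = 0 := hf0 fun hx' => hx hx'.1
              rw [hFx, this]
              simp
        _ = volume U := by rw [lintegral_indicator_const hU.measurableSet, one_mul]
        _ ≤ ε := hUε
    rw [h3] at h1
    exact h1.trans (by gcongr)
  have hB1 : B + 1 ≠ (⊤ : ℝ≥0∞) := ENNReal.add_ne_top.2 ⟨h.ne, ENNReal.one_ne_top⟩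
  have hm2 : m ^ 2 ≠ 0 := pow_ne_zero 2 hm0
  have hmtop : m ^ 2 ≠ (⊤ : ℝ≥0∞) := ENNReal.pow_ne_top (measure_ne_top _ _)
  -- `B + 1` rather than `B`, so that the quotient makes sense when `B = 0`.
  have h5 := hkey (m ^ 2 / (2 * (B + 1)))
    (ENNReal.div_ne_zero.2 ⟨hm2, ENNReal.mul_ne_top ENNReal.ofNat_ne_top hB1⟩)
  have h6 : B * (m ^ 2 / (2 * (B + 1))) ≤ m ^ 2 / 2 := by
    calc B * (m ^ 2 / (2 * (B + 1))) ≤ (B + 1) * (m ^ 2 / (2 * (B + 1))) := by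
          gcongr
          exact le_self_add
      _ = m ^ 2 / 2 := by
          rw [← mul_div_assoc, mul_comm 2, ENNReal.mul_div_mul_left _ _ (by simp) hB1]
  exact absurd (h5.trans h6) (not_le.2 (ENNReal.half_lt_self hm2 hmtop))

end SquareIntegrable

/-! ### Measures on `T • E` and `T • E + Z` -/

section Images

open Filter Topology

theorem exists_isCompact_image_prod {X Y W : Type*} [TopologicalSpace X] [TopologicalSpace Y]
    [TopologicalSpace W] [T2Space X] [T2Space Y] [T2Space W]
    [MeasurableSpace X] [MeasurableSpace Y] [MeasurableSpace W] [OpensMeasurableSpace X]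
    [OpensMeasurableSpace Y] [BorelSpace W] [OpensMeasurableSpace (X × Y)]
    {μ : Measure X} {ν : Measure Y} [IsFiniteMeasure μ] [IsFiniteMeasure ν] (hμ0 : μ ≠ 0)
    (hν0 : ν ≠ 0) {K : Set X} {L : Set Y} (hK : IsCompact K) (hL : IsCompact L)
    (hμK : μ Kᶜ = 0) (hνL : ν Lᶜ = 0) {f : X × Y → W} (hf : Continuous f) :
    IsCompact (f '' K ×ˢ L) ∧ (μ.prod ν).map f ≠ 0 ∧ (μ.prod ν).map f (f '' K ×ˢ L)ᶜ = 0 := by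
  have hc : IsCompact (f '' K ×ˢ L) := (hK.prod hL).image hf
  refine ⟨hc, ?_, ?_⟩
  · rw [Measure.map_ne_zero_iff hf.measurable.aemeasurable, ← Measure.measure_univ_ne_zero,
      ← Set.univ_prod_univ, Measure.prod_prod]
    exact mul_ne_zero (Measure.measure_univ_ne_zero.2 hμ0) (Measure.measure_univ_ne_zero.2 hν0)
  · rw [Measure.map_apply hf.measurable hc.measurableSet.compl]
    refine measure_mono_null (t := Kᶜ ×ˢ Set.univ ∪ Set.univ ×ˢ Lᶜ) ?_ ?_
    · rintro ⟨x, y⟩ hxy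
      by_contra hcon
      simp only [Set.mem_union, Set.mem_prod, Set.mem_compl_iff, Set.mem_univ, and_true, true_and,
        not_or, not_not] at hcon
      exact hxy ⟨(x, y), hcon, rfl⟩
    · refine measure_union_null ?_ ?_
      · rw [Measure.prod_prod, hμK, zero_mul]
      · rw [Measure.prod_prod, hνL, mul_zero]

theorem gaussianDamp_ne_zero {ν : Measure ℝ} (hν : ν ≠ 0) : gaussianDamp ν ≠ 0 := by
  rw [gaussianDamp, Ne, withDensity_eq_zero_iff (by fun_prop)]
  intro h
  apply hν
  rw [← ae_eq_bot, ← eventually_false_iff_eq_bot]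
  filter_upwards [h] with r hr
  have : Real.exp (-Real.pi * r ^ 2) ≤ 0 := by simpa using hr
  exact absurd this (not_le.2 (Real.exp_pos _))

theorem gaussianDamp_null {ν : Measure ℝ} {A : Set ℝ} (h : ν A = 0) : gaussianDamp ν A = 0 :=
  withDensity_absolutelyContinuous ν _ h

variable {V : Type*} [NormedAddCommGroup V] [InnerProductSpace ℝ V] [FiniteDimensional ℝ V]
  [MeasurableSpace V] [BorelSpace V]

/-- The set `T • E` carries measures with power Fourier decay. -/
theorem exists_measure_smul_norm_sq_mhat_le {E : Set V} {T : Set ℝ} (hE : MeasurableSet E)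
    (hT : MeasurableSet T) (hEne : E.Nonempty) (hTne : T.Nonempty) {s : ℝ}
    (hs : s < (dimH E).toReal + (dimH T).toReal - Module.finrank ℝ V) :
    ∃ K ⊆ T • E, IsCompact K ∧ ∃ μ : Measure V, IsFiniteMeasure μ ∧ μ ≠ 0 ∧ μ Kᶜ = 0 ∧
      ∃ C : ℝ, 0 ≤ C ∧ ∀ ξ, ‖mhat μ ξ‖ ^ 2 ≤ C * (1 + ‖ξ‖) ^ (-s) := by
  set ε := ((dimH E).toReal + (dimH T).toReal - Module.finrank ℝ V - s) / 2 with hε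
  have hε0 : 0 < ε := by rw [hε]; linarith
  obtain ⟨a, ha, KE, hKE, hKEc, μ, hμfin, hμ0, hμK, hμF⟩ := exists_isFrostman_add_lt hE hEne hε0
  obtain ⟨t, ht, KT, hKT, hKTc, ν, hνfin, hν0, hνK, hνF⟩ := exists_isFrostman_add_lt hT hTne hε0
  obtain ⟨M, hM⟩ := hKEc.isBounded.exists_norm_le
  have hM' : ∀ᵐ x ∂μ, ‖x‖ ≤ M := by
    filter_upwards [measure_eq_zero_iff_ae_notMem.1 hμK] with x hx
    exact hM x (by simpa using hx)
  obtain ⟨C, hC0, hC⟩ := norm_sq_mhat_map_smul_le hμF hM' hνF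
  obtain ⟨h1, h2, h3⟩ := exists_isCompact_image_prod (gaussianDamp_ne_zero hν0) hμ0 hKTc hKEc
    (gaussianDamp_null hνK) hμK (f := fun p : ℝ × V => p.1 • p.2) (by fun_prop)
  refine ⟨_, ?_, h1, _, inferInstance, h2, h3, C, hC0, fun ξ => (hC ξ).trans ?_⟩
  · rintro _ ⟨⟨r, x⟩, ⟨hr, hx⟩, rfl⟩
    exact Set.smul_mem_smul (hKT hr) (hKE hx)
  · gcongr
    · linarith [norm_nonneg ξ]
    · rw [hε] at ha ht
      linarith

theorem mhat_map_add (μ ν : Measure V) [IsFiniteMeasure μ] [IsFiniteMeasure ν] (ξ : V) :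
    mhat ((μ.prod ν).map fun p => p.1 + p.2) ξ = mhat μ ξ * mhat ν ξ := by
  have hc : Continuous fun x : V => fourierExp (inner ℝ ξ x) :=
    continuous_fourierExp.comp (by fun_prop)
  rw [mhat, integral_map (by fun_prop) hc.aestronglyMeasurable, mhat, mhat, ← integral_prod_mul]
  simp_rw [inner_add_right, fourierExp_add]

/-- The set `T • E + Z` carries probability measures of large Sobolev dimension. -/
theorem exists_measure_smul_add_lintegral_lt_top {E Z : Set V} {T : Set ℝ}
    (hE : MeasurableSet E) (hZ : MeasurableSet Z) (hT : MeasurableSet T) (hEne : E.Nonempty)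
    (hZne : Z.Nonempty) (hTne : T.Nonempty) {s : ℝ}
    (hs : s < (dimH E).toReal + (dimH Z).toReal + (dimH T).toReal - Module.finrank ℝ V) :
    ∃ K ⊆ T • E + Z, IsCompact K ∧ ∃ μ : Measure V, IsProbabilityMeasure μ ∧ μ Kᶜ = 0 ∧
      ∫⁻ ξ : V, ENNReal.ofReal (‖mhat μ ξ‖ ^ 2 *
        (1 + ‖ξ‖) ^ (s - (Module.finrank ℝ V : ℝ))) < ∞ := by
  set D := Module.finrank ℝ V with hD
  -- One `ε` is lost in the decay exponent `s₁`, one in the Frostman exponent `z` on `Z`; the third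
  -- leaves room for `s - s₁ < z`.
  set ε := ((dimH E).toReal + (dimH Z).toReal + (dimH T).toReal - D - s) / 3 with hε
  have hε0 : 0 < ε := by rw [hε]; linarith
  set s₁ := (dimH E).toReal + (dimH T).toReal - D - ε with hs₁
  obtain ⟨K, hK, hKc, lam, hlamfin, hlam0, hlamK, C, hC0, hC⟩ :=
    exists_measure_smul_norm_sq_mhat_le hE hT hEne hTne (s := s₁) (by rw [hs₁]; linarith)
  obtain ⟨z, hz, KZ, hKZ, hKZc, ζ, hζfin, hζ0, hζK, hζF⟩ := exists_isFrostman_add_lt hZ hZne hε0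
  obtain ⟨h1, h2, h3⟩ := exists_isCompact_image_prod hlam0 hζ0 hKc hKZc hlamK hζK
    (f := fun p : V × V => p.1 + p.2) (by fun_prop)
  set μ := (lam.prod ζ).map fun p : V × V => p.1 + p.2 with hμ
  have hv : s - s₁ < z := by
    have : s = (dimH E).toReal + (dimH Z).toReal + (dimH T).toReal - D - 3 * ε := by rw [hε]; ring
    rw [this, hs₁]
    linarith
  have hfin := hζF.lintegral_norm_sq_mhat_lt_top hv
  have hmu0 : μ Set.univ ≠ 0 := Measure.measure_univ_ne_zero.2 h2
  set c : ℝ≥0∞ := (μ Set.univ)⁻¹ with hc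
  have hctop : c ≠ ∞ := ENNReal.inv_ne_top.2 hmu0
  have hmhat : ∀ ξ, mhat (c • μ) ξ = c.toReal * (mhat lam ξ * mhat ζ ξ) := fun ξ => by
    rw [← mhat_map_add, mhat, integral_smul_measure, Complex.real_smul, ← mhat]
  refine ⟨_, ?_, h1, c • μ, ⟨?_⟩, ?_, ?_⟩
  · rintro _ ⟨⟨x, y⟩, ⟨hx, hy⟩, rfl⟩
    exact Set.add_mem_add (hK hx) (hKZ hy)
  · rw [Measure.smul_apply, smul_eq_mul, hc, ENNReal.inv_mul_cancel hmu0 (measure_ne_top _ _)]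
  · rw [Measure.smul_apply, h3, smul_zero]
  · have hpt : ∀ ξ : V, ENNReal.ofReal (‖mhat (c • μ) ξ‖ ^ 2 * (1 + ‖ξ‖) ^ (s - (D : ℝ)))
        ≤ ENNReal.ofReal (c.toReal ^ 2 * C) *
          ENNReal.ofReal (‖mhat ζ ξ‖ ^ 2 * (1 + ‖ξ‖) ^ (s - s₁ - (D : ℝ))) := fun ξ => by
      have hpos : 0 < 1 + ‖ξ‖ := by positivity
      rw [← ENNReal.ofReal_mul (by positivity)]
      refine ENNReal.ofReal_le_ofReal ?_
      rw [hmhat, norm_mul, norm_mul, Complex.norm_real, Real.norm_of_nonneg ENNReal.toReal_nonneg]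
      calc (c.toReal * (‖mhat lam ξ‖ * ‖mhat ζ ξ‖)) ^ 2 * (1 + ‖ξ‖) ^ (s - (D : ℝ))
          = c.toReal ^ 2 * ‖mhat lam ξ‖ ^ 2 * ‖mhat ζ ξ‖ ^ 2 * (1 + ‖ξ‖) ^ (s - (D : ℝ)) := by ring
        _ ≤ c.toReal ^ 2 * (C * (1 + ‖ξ‖) ^ (-s₁)) * ‖mhat ζ ξ‖ ^ 2 *
            (1 + ‖ξ‖) ^ (s - (D : ℝ)) := by
            gcongr
            exact hC ξ
        _ = _ := by
            rw [show s - s₁ - (D : ℝ) = -s₁ + (s - D) by ring, Real.rpow_add hpos]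
            ring
    refine (lintegral_mono hpt).trans_lt ?_
    rw [lintegral_const_mul' _ _ ENNReal.ofReal_ne_top]
    exact ENNReal.mul_lt_top ENNReal.ofReal_lt_top hfin

end Images

/-! ### The dimension and volume bounds -/

theorem hasCompactSupportIn_of_compl_null {d : ℕ} {μ : Measure (EuclideanSpace ℝ (Fin d))}
    [IsFiniteMeasure μ] (hμ : μ ≠ 0) {K A : Set (EuclideanSpace ℝ (Fin d))} (hK : IsCompact K)
    (hμK : μ Kᶜ = 0) (hKA : K ⊆ A) : HasCompactSupportIn μ A := by
  have h : μ.support ⊆ K := Measure.support_subset_of_isClosed hK.isClosed (mem_ae_iff.2 hμK)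
  exact ⟨hμ, inferInstance, hK.of_isClosed_subset Measure.isClosed_support h, h.trans hKA⟩

theorem mainTheorem1 (d : ℕ) (hd : 1 ≤ d)
    (E Z : Set (EuclideanSpace ℝ (Fin d))) (T : Set ℝ)
    (hE : MeasurableSet E) (hZ : MeasurableSet Z) (hT : MeasurableSet T)
    (hTpos : T ⊆ Set.Ioi (0 : ℝ))
    (hEne : E.Nonempty) (hZne : Z.Nonempty) (hTne : T.Nonempty) :
    (((dimH E : ℝ≥0∞) : EReal) + ((dimH T : ℝ≥0∞) : EReal) - ((d : ℝ) : EReal)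
        ≤ fourierDim (T • E)
      ∧ ((dimH E : ℝ≥0∞) : EReal) + ((dimH Z : ℝ≥0∞) : EReal) + ((dimH T : ℝ≥0∞) : EReal)
          - ((d : ℝ) : EReal)
        ≤ sobolevDim (T • E + Z))
    ∧ (2 * (d : ℝ≥0∞) < dimH E + dimH Z + dimH T →
        0 < volume (T • E + Z))
    ∧ (∀ u : ℝ, 0 < u → u < (d : ℝ) →
        (d : ℝ≥0∞) + ENNReal.ofReal u < dimH E + dimH Z + dimH T →
        ENNReal.ofReal u ≤ dimH (T • E + Z)) := by
  have hrank : Module.finrank ℝ (EuclideanSpace ℝ (Fin d)) = d := finrank_euclideanSpace_fin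
  have hEtop : dimH E ≠ ∞ := Real.dimH_ne_top E
  have hZtop : dimH Z ≠ ∞ := Real.dimH_ne_top Z
  have hTtop : dimH T ≠ ∞ := Real.dimH_ne_top T
  -- With `dimH T ≤ 1 ≤ d` this gives `dimH E + dimH T - d ≤ d`, so every admissible `s` meets the
  -- cap in `fourierDim`.
  have hEd : (dimH E).toReal ≤ d := by
    refine ENNReal.toReal_le_of_le_ofReal (Nat.cast_nonneg d) ?_
    rw [ENNReal.ofReal_natCast]
    refine (dimH_mono (Set.subset_univ E)).trans (le_of_eq ?_)
    rw [Real.dimH_univ_eq_finrank, hrank]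
  have hT1 : (dimH T).toReal ≤ 1 := by
    refine ENNReal.toReal_le_of_le_ofReal zero_le_one ?_
    rw [ENNReal.ofReal_one, ← Real.dimH_univ]
    exact dimH_mono (Set.subset_univ T)
  have hd' : (1 : ℝ) ≤ d := by exact_mod_cast hd
  have hsum : (dimH E + dimH Z + dimH T).toReal
      = (dimH E).toReal + (dimH Z).toReal + (dimH T).toReal := by
    rw [ENNReal.toReal_add (ENNReal.add_ne_top.2 ⟨hEtop, hZtop⟩) hTtop,
      ENNReal.toReal_add hEtop hZtop]
  have hsumtop : dimH E + dimH Z + dimH T ≠ ∞ :=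
    ENNReal.add_ne_top.2 ⟨ENNReal.add_ne_top.2 ⟨hEtop, hZtop⟩, hTtop⟩
  rw [← EReal.coe_ennreal_toReal hEtop, ← EReal.coe_ennreal_toReal hZtop,
    ← EReal.coe_ennreal_toReal hTtop, ← EReal.coe_add, ← EReal.coe_sub, ← EReal.coe_add,
    ← EReal.coe_add, ← EReal.coe_sub]
  refine ⟨⟨?_, ?_⟩, fun h => ?_, fun u hu hud h => ?_⟩
  · refine EReal.ge_of_forall_gt_iff_ge.1 fun s hs => ?_
    have hs' := EReal.coe_lt_coe_iff.1 hs
    obtain ⟨K, hKsub, hK, μ, hμfin, hμ0, hμK, C, hC0, hC⟩ :=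
      exists_measure_smul_norm_sq_mhat_le hE hT hEne hTne (s := s) (by rwa [hrank])
    refine le_sSup ⟨s, rfl, by linarith, μ, hasCompactSupportIn_of_compl_null hμ0 hK hμK hKsub,
      Real.sqrt C, fun ξ => ?_⟩
    have hpos : (0 : ℝ) < 1 + ‖ξ‖ := by positivity
    refine le_of_pow_le_pow_left₀ two_ne_zero (by positivity) ?_
    rw [mul_pow, Real.sq_sqrt hC0, ← Real.rpow_natCast ((1 + ‖ξ‖) ^ (-s / 2)),
      ← Real.rpow_mul hpos.le]
    refine (hC ξ).trans (le_of_eq ?_)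
    congr 2
    push_cast
    ring
  · refine EReal.ge_of_forall_gt_iff_ge.1 fun s hs => ?_
    have hs' := EReal.coe_lt_coe_iff.1 hs
    obtain ⟨K, hKsub, hK, μ, hμprob, hμK, hfin⟩ := exists_measure_smul_add_lintegral_lt_top
      hE hZ hT hEne hZne hTne (s := s) (by rwa [hrank])
    rw [hrank] at hfin
    have h1 : (s : EReal) ≤ sobolevDimMeasure μ := le_sSup ⟨s, rfl, hfin⟩
    exact h1.trans (le_sSup ⟨μ, hμprob, hasCompactSupportIn_of_compl_null
      (IsProbabilityMeasure.ne_zero μ) hK hμK hKsub, rfl⟩)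
  · have h' : 2 * (d : ℝ) < (dimH E).toReal + (dimH Z).toReal + (dimH T).toReal := by
      rw [← hsum]
      have := (ENNReal.toReal_lt_toReal (by finiteness) hsumtop).2 h
      simpa using this
    -- At `s = d` the Sobolev weight is constant, so finiteness says that the transform is in `L²`.
    obtain ⟨K, hKsub, hK, μ, hμprob, hμK, hfin⟩ := exists_measure_smul_add_lintegral_lt_top
      hE hZ hT hEne hZne hTne (s := d) (by rw [hrank]; linarith)
    refine (volume_pos_of_lintegral_norm_sq_mhat_lt_top (IsProbabilityMeasure.ne_zero μ) hK hμK
      ?_).trans_le (measure_mono hKsub)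
    refine lt_of_le_of_lt (lintegral_mono fun ξ => le_of_eq ?_) hfin
    rw [hrank, sub_self, Real.rpow_zero, mul_one, ENNReal.ofReal_pow (norm_nonneg _), ofReal_norm]
  · have h' : (d : ℝ) + u < (dimH E).toReal + (dimH Z).toReal + (dimH T).toReal := by
      rw [← hsum]
      have := (ENNReal.toReal_lt_toReal (by finiteness) hsumtop).2 h
      rwa [ENNReal.toReal_add (by finiteness) (by finiteness), ENNReal.toReal_natCast,
        ENNReal.toReal_ofReal hu.le] at this
    set S := (dimH E).toReal + (dimH Z).toReal + (dimH T).toReal with hS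
    -- An exponent strictly above `u` and below `S - d`, capped at `d` because the passage from
    -- Sobolev integral to energy needs `s ≤ d`.
    set s := min (d : ℝ) ((u + (S - d)) / 2) with hs
    have hus : u < s := lt_min hud (by linarith)
    have hsd : s ≤ d := min_le_left _ _
    have hsS : s < S - d := (min_le_right _ _).trans_lt (by linarith)
    obtain ⟨K, hKsub, hK, μ, hμprob, hμK, hfin⟩ := exists_measure_smul_add_lintegral_lt_top
      hE hZ hT hEne hZne hTne (s := s) (by rwa [hrank])
    obtain ⟨K', hK'K, hK'c, hK'pos, hF⟩ := exists_isFrostman_restrict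
      (IsProbabilityMeasure.ne_zero μ) hu.le hK hμK
      (tsum_lintegral_ball_ne_top hus (by rwa [hrank]) hfin)
    refine (hF.le_dimH hu (S := K') ?_).trans (dimH_mono (hK'K.trans hKsub))
    rwa [Measure.restrict_apply_self]
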